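/- Let $L,a,b,c,M,N>0$ and $p\in L^1[0,L]$, and consider the boundary value problem $$w''''-\Big(a+b\int_0^L w\Big)w''+c\int_0^L w=p(x)\ \text{ for a.e. }x\in(0,L),\qquad w(0)=w(L)=w''(0)=w''(L)=0, \tag{P}$$ with solutions in $W^{4,1}[0,L]$. A lower (upper) solution is a function in $W^{4,1}[0,L]$ that satisfies the same boundary conditions and the differential equation with $=$ replaced by $\le$ ($\ge$). For functions $u,v\in C^2[0,L]$ write $u\preceq v$ if $u\le v$ and $u''\ge v''$ on $[0,L]$, let $[\alpha,\beta]=\{u\in C^2[0,L]:\alpha\preceq u\preceq\beta\}$, and let $\|\cdot\|_\infty$ be the supremum norm on $[0,L]$. Assume that $$N\le\frac{4M}{L^3}\,\sigma(\sqrt M L),\qquad \sigma(t)=\frac{3t^3}{6t\cosh t+6t-12\sinh t-t^3},$$ that $\alpha$ is a lower solution and $\beta$ an upper solution of (P) with $0\le\alpha\le\beta$ and $0\ge\alpha''\ge\beta''$ on $[0,L]$, that $$a+b\int_0^L\beta\le M,\qquad c-b\min_{[0,L]}\beta''\le N,$$ and that $$a+b\int_0^L\alpha+\frac{L^3}{4}c>\frac{L^3N}{4}+M-\frac{4}{L^2}.$$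 Put $$\rho=\frac{L\tanh(\sqrt M L/2)}{2\sqrt M}\Big[M-\Big(a+b\int_0^L\alpha\Big)+\frac{L^3}{4}\Big(N-c+b\max_{[0,L]}\alpha''\Big)\Big].$$ Let $(\alpha_n)_{n\ge0}$ and $(\beta_n)_{n\ge0}$ be the sequences with $\alpha_0=\alpha$, $\beta_0=\beta$ whose further terms $y_n\in W^{4,1}[0,L]$, $n\ge1$, are the solutions of the linear problems $$y_n''''-My_n''+N\int_0^L y_n=p+ay_{n-1}''+by_{n-1}''\int_0^L y_{n-1}-c\int_0^L y_{n-1}-My_{n-1}''+N\int_0^L y_{n-1}\ \text{ a.e. on }(0,L),$$ $$y_n(0)=y_n(L)=y_n''(0)=y_n''(L)=0 .$$ Then $0\le\rho<1$, these sequences exist, problem (P) has exactly one solution $\widetilde y$ in $[\alpha,\beta]$, the sequences are monotone, $\alpha_n\preceq\alpha_{n+1}$, $\beta_{n+1}\preceq\beta_n$ and $\alpha_n\preceq\beta_n$ for all $n\ge0$, and both converge to $\widetilde y$ uniformly on $[0,L]$. Moreover, for $(y_n)=(\alpha_n)$ and for $(y_n)=(\beta_n)$ and all $n\ge0$, $$\|y_{n+1}-y_n\|_\infty\le\frac{L^2}{4}\|y_{n+1}''-y_n''\|_\infty\le\frac{L^2}{4}\rho^n\|y_1''-y_0''\|_\infty\le\frac{L^2}{4}\rho^n\|\alpha''-\beta''\|_\infty,$$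 $$\|y_n-\widetilde y\|_\infty\le\frac{L^2}{4}\|y_n''-\widetilde y''\|_\infty\le\frac{L^2}{4}\,\frac{\rho^n}{1-\rho}\,\|\alpha''-\beta''\|_\infty,$$ and the right-hand sides tend to $0$ as $n\to\infty$. -/

import Mathlib

open Set MeasureTheory Filter Topology

noncomputable section

namespace Melan

/-- The `k`-th derivative of a function on `[0, L]` (one-sided at the end points); it depends only
on the values of `y` on `[0, L]`. -/
def D (L : ℝ) (k : ℕ) (y : ℝ → ℝ) : ℝ → ℝ :=
  iteratedDerivWithin k y (Icc 0 L)

/-- `y ∈ W^{4,1}[0, L]` (for the continuous representative): `y` is `C³` on `[0, L]` and `y'''` is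
absolutely continuous on `[0, L]`. The fourth derivative `D L 4 y` then exists almost everywhere. -/
def MemW41 (L : ℝ) (y : ℝ → ℝ) : Prop :=
  ContDiffOn ℝ 3 y (Icc 0 L) ∧ AbsolutelyContinuousOnInterval (D L 3 y) 0 L

/-- Boundary conditions `y(0) = y(L) = y''(0) = y''(L) = 0`. -/
def NavierBC (L : ℝ) (y : ℝ → ℝ) : Prop :=
  y 0 = 0 ∧ y L = 0 ∧ D L 2 y 0 = 0 ∧ D L 2 y L = 0

/-- The norm `‖g‖_∞ = sup_{x ∈ [0, L]} |g x|` of a bounded function on `[0, L]`. -/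
def supNorm (L : ℝ) (g : ℝ → ℝ) : ℝ :=
  sSup ((fun x => |g x|) '' Icc 0 L)

/-- The nonlinear nonlocal expression
`w'''' - (a + b ∫₀ᴸ w) w'' + c ∫₀ᴸ w`. -/
def melanOp (L a b c : ℝ) (w : ℝ → ℝ) (x : ℝ) : ℝ :=
  D L 4 w x - (a + b * ∫ t in (0 : ℝ)..L, w t) * D L 2 w x + c * ∫ t in (0 : ℝ)..L, w t

/-- The linear operator `G w = w'''' - M w'' + N ∫₀ᴸ w`. -/
def linOp (L M N : ℝ) (w : ℝ → ℝ) (x : ℝ) : ℝ :=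
  D L 4 w x - M * D L 2 w x + N * ∫ t in (0 : ℝ)..L, w t

/-- `f(x, ∫₀ᴸ y, y''(x)) = p(x) + a y''(x) + b y''(x) ∫₀ᴸ y - c ∫₀ᴸ y`. -/
def rhs (L a b c : ℝ) (p y : ℝ → ℝ) (x : ℝ) : ℝ :=
  p x + a * D L 2 y x + b * D L 2 y x * (∫ t in (0 : ℝ)..L, y t) - c * ∫ t in (0 : ℝ)..L, y t

/-- Solutions in `W^{4,1}[0, L]` of the boundary value problem. -/
def IsSolution (L a b c : ℝ) (p y : ℝ → ℝ) : Prop :=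
  MemW41 L y ∧ (∀ᵐ x ∂volume.restrict (Ioo 0 L), melanOp L a b c y x = p x) ∧ NavierBC L y

def IsLowerSolution (L a b c : ℝ) (p y : ℝ → ℝ) : Prop :=
  MemW41 L y ∧ (∀ᵐ x ∂volume.restrict (Ioo 0 L), melanOp L a b c y x ≤ p x) ∧ NavierBC L y

def IsUpperSolution (L a b c : ℝ) (p y : ℝ → ℝ) : Prop :=
  MemW41 L y ∧ (∀ᵐ x ∂volume.restrict (Ioo 0 L), p x ≤ melanOp L a b c y x) ∧ NavierBC L y

/-- `u ≤ v` and `u'' ≥ v''` on `[0, L]`. -/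
def Below (L : ℝ) (u v : ℝ → ℝ) : Prop :=
  ∀ x ∈ Icc (0 : ℝ) L, u x ≤ v x ∧ D L 2 v x ≤ D L 2 u x

/-- The sector `[α, β] = {u ∈ C²[0, L] | α ≤ u ≤ β, α'' ≥ u'' ≥ β''}`. -/
def sector (L : ℝ) (α β : ℝ → ℝ) : Set (ℝ → ℝ) :=
  {u | ContDiffOn ℝ 2 u (Icc 0 L) ∧ Below L α u ∧ Below L u β}

/-- `Y` is a sequence produced by the iterative procedure
`G yₙ = f(x, ∫₀ᴸ yₙ₋₁, yₙ₋₁'') - M yₙ₋₁'' + N ∫₀ᴸ yₙ₋₁` with the Navier boundary conditions,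
started at `y₀`. -/
def IsIteration (L a b c M N : ℝ) (p y₀ : ℝ → ℝ) (Y : ℕ → ℝ → ℝ) : Prop :=
  Y 0 = y₀ ∧ ∀ n, MemW41 L (Y (n + 1)) ∧
    (∀ᵐ x ∂volume.restrict (Ioo 0 L), linOp L M N (Y (n + 1)) x =
      rhs L a b c p (Y n) x - M * D L 2 (Y n) x + N * ∫ t in (0 : ℝ)..L, Y n t) ∧
    NavierBC L (Y (n + 1))

/-- `σ(t) = 3t³ / (6 t cosh t + 6 t - 12 sinh t - t³)`. -/
def sigma (t : ℝ) : ℝ :=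
  3 * t ^ 3 / (6 * t * Real.cosh t + 6 * t - 12 * Real.sinh t - t ^ 3)

/-- The contraction rate
`ρ = L tanh(√M L / 2) / (2√M) · [M - (a + b ∫₀ᴸ α) + L³/4 (N - c + b max α'')]`. -/
def rho (L a b c M N : ℝ) (α : ℝ → ℝ) : ℝ :=
  L * (Real.tanh (√M * L / 2) / (2 * √M)) *
    (M - (a + b * ∫ t in (0 : ℝ)..L, α t)
      + L ^ 3 / 4 * (N - c + b * sSup (D L 2 α '' Icc 0 L)))

end Melan

end

open Set MeasureTheory Filter Topology

namespace Melan

/-! Put `M = m²` and `u = -y''`. If `y` vanishes at both ends, then `∫ y = K(u) := ∫ bump · u`,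
where `bump` is the Dirichlet solution of `-e'' = 1`. Hence the linear problem becomes the
second-order Dirichlet problem `-u'' + m² u + N K(u) = h`, one step of the iteration has `h = F(u) =
p + (m² - a - b K(u)) u + (N - c) K(u)` (`force`), and solutions of (P) are the fixed points of the
step. The relation `⪯` becomes the pointwise order of `u`.

The heart is the comparison principle `IsLinSol.nonneg`. The nonlocal term is a rank-one
perturbation of `-d²/dx² + m²`. With `G` the Green kernel, `τ = tauOne` and `q = tauBump` the
responses to `1` and to `bump`, and `C = ∫ bump · τ`, the solution operator has kernel `G(x,s) - N
τ(x) q(s) / (1 + N C)`. Both `τ` and `q` lie below multiples of `sinh (m x)` that are tangent to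
them at `0`, so positivity reduces to one inequality between constants, `kernel_constant_le`; this
is where `σ` enters.

Between `-α''` and `-β''` the bounds by `M` and `N` make `F` increasing, so a step preserves order
and the interval. Comparison with multiples of `τ` bounds the linear solution operator in sup norm
by `L tanh(mL/2)/(2m)`. The bracket in `ρ` is a Lipschitz constant of `F`, since `max α'' = 0`. Thus
a step is a `ρ`-contraction (`step_contract`), and `tanh z ≤ z` gives `ρ < 1`. Banach's theorem
yields the solution; iterating the contraction and the monotonicity yields uniqueness, the ordering
and the error bounds. -/

/-! ### Calculus of absolutely continuous functions. -/

/-- `f` is absolutely continuous on `[0, L]` with almost everywhere derivative `f'`. -/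
def IsPrimitive (L : ℝ) (f f' : ℝ → ℝ) : Prop :=
  IntervalIntegrable f' volume 0 L ∧ ∀ x ∈ Icc 0 L, f x = f 0 + ∫ t in (0 : ℝ)..x, f' t

theorem ae_restrict_Ioo_iff {L : ℝ} {P : ℝ → Prop} :
    (∀ᵐ x ∂volume.restrict (Ioo 0 L), P x) ↔ ∀ᵐ x, x ∈ Ioo 0 L → P x :=
  ae_restrict_iff' measurableSet_Ioo

theorem ae_ne_pt (a : ℝ) : ∀ᵐ x : ℝ, x ≠ a := by simp [ae_iff, measure_singleton]

theorem ae_Ioo_to_uIoc {L x : ℝ} (hx : x ∈ Icc 0 L) {P : ℝ → Prop}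
    (h : ∀ᵐ t ∂volume.restrict (Ioo 0 L), P t) : ∀ᵐ t, t ∈ uIoc 0 x → P t := by
  filter_upwards [ae_restrict_Ioo_iff.1 h, ae_ne_pt L] with t ht htL hmem
  rw [uIoc_of_le hx.1] at hmem
  exact ht ⟨hmem.1, lt_of_le_of_ne (hmem.2.trans hx.2) htL⟩

theorem intervalIntegrable_sub {L x : ℝ} {g : ℝ → ℝ} (hx : x ∈ Icc 0 L)
    (h : IntervalIntegrable g volume 0 L) :
    IntervalIntegrable g volume 0 x ∧ IntervalIntegrable g volume x L := by
  constructor <;> refine h.mono_set ?_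
  · rw [uIcc_of_le hx.1, uIcc_of_le (hx.1.trans hx.2)]; exact Icc_subset_Icc_right hx.2
  · rw [uIcc_of_le hx.2, uIcc_of_le (hx.1.trans hx.2)]; exact Icc_subset_Icc_left hx.1

theorem integral_congr_Ioo {L : ℝ} (hL : 0 ≤ L) {f g : ℝ → ℝ}
    (h : ∀ᵐ t ∂volume.restrict (Ioo 0 L), f t = g t) :
    ∫ t in (0 : ℝ)..L, f t = ∫ t in (0 : ℝ)..L, g t :=
  intervalIntegral.integral_congr_ae (ae_Ioo_to_uIoc ⟨hL, le_rfl⟩ h)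

theorem intervalIntegrable_congr_Ioo {L : ℝ} (hL : 0 ≤ L) {f g : ℝ → ℝ}
    (hf : IntervalIntegrable f volume 0 L)
    (h : ∀ᵐ t ∂volume.restrict (Ioo 0 L), f t = g t) :
    IntervalIntegrable g volume 0 L := by
  refine hf.congr_ae ?_
  rw [EventuallyEq, ae_restrict_iff' measurableSet_uIoc]
  exact ae_Ioo_to_uIoc ⟨hL, le_rfl⟩ h

theorem intervalIntegrable_of_continuousOn {L : ℝ} (hL : 0 ≤ L) {f : ℝ → ℝ}
    (hf : ContinuousOn f (Icc 0 L)) : IntervalIntegrable f volume 0 L :=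
  ContinuousOn.intervalIntegrable (by rwa [uIcc_of_le hL])

theorem ae_of_forall_Icc {L : ℝ} {P : ℝ → Prop} (h : ∀ x ∈ Icc 0 L, P x) :
    ∀ᵐ t ∂volume.restrict (Ioo 0 L), P t :=
  ae_restrict_Ioo_iff.2 (Eventually.of_forall fun x hx => h x (Ioo_subset_Icc_self hx))

theorem absolutelyContinuousOnInterval_congr {a b : ℝ} {f g : ℝ → ℝ} (h : EqOn f g (uIcc a b))
    (hf : AbsolutelyContinuousOnInterval f a b) : AbsolutelyContinuousOnInterval g a b := by
  rw [absolutelyContinuousOnInterval_iff] at hf ⊢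
  intro ε hε
  obtain ⟨δ, hδ, H⟩ := hf ε hε
  refine ⟨δ, hδ, fun E hE hl => ?_⟩
  refine lt_of_eq_of_lt (Finset.sum_congr rfl fun i hi => ?_) (H E hE hl)
  rw [h (hE.1 i hi).1, h (hE.1 i hi).2]

namespace IsPrimitive

variable {L : ℝ} {f f' g g' : ℝ → ℝ}

theorem of_absolutelyContinuous (hf : AbsolutelyContinuousOnInterval f 0 L) :
    IsPrimitive L f (deriv f) := by
  refine ⟨hf.intervalIntegrable_deriv, fun x hx => ?_⟩
  have : AbsolutelyContinuousOnInterval f 0 x := hf.mono (by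
    rw [uIcc_of_le hx.1, uIcc_of_le (hx.1.trans hx.2)]; exact Icc_subset_Icc_right hx.2)
  rw [this.integral_deriv_eq_sub]; ring

theorem absolutelyContinuous (hL : 0 ≤ L) (hf : IsPrimitive L f f') :
    AbsolutelyContinuousOnInterval f 0 L := by
  have h0 := hf.1.absolutelyContinuousOnInterval_intervalIntegral (c := 0) (by simp)
  have hc : AbsolutelyContinuousOnInterval (fun _ : ℝ => f 0) 0 L :=
    (contDiffOn_const (𝕜 := ℝ) (n := 1)).absolutelyContinuousOnInterval
  refine absolutelyContinuousOnInterval_congr ?_ (hc.fun_add h0)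
  intro x hx
  rw [uIcc_of_le hL] at hx
  exact (hf.2 x hx).symm

theorem continuousOn (hL : 0 ≤ L) (hf : IsPrimitive L f f') : ContinuousOn f (Icc 0 L) := by
  simpa [uIcc_of_le hL] using (hf.absolutelyContinuous hL).continuousOn

theorem ae_hasDerivAt (hf : IsPrimitive L f f') :
    ∀ᵐ x ∂volume.restrict (Ioo 0 L), HasDerivAt f (f' x) x := by
  rw [ae_restrict_Ioo_iff]
  filter_upwards [hf.1.ae_hasDerivAt_integral] with x hx hmem
  have hL : 0 ≤ L := (hmem.1.trans hmem.2).le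
  have h1 := (hx (by rw [uIcc_of_le hL]; exact Ioo_subset_Icc_self hmem) 0
    (by simp)).const_add (f 0)
  refine h1.congr_of_eventuallyEq ?_
  filter_upwards [Ioo_mem_nhds hmem.1 hmem.2] with t ht
  exact hf.2 t (Ioo_subset_Icc_self ht)

theorem congr (hL : 0 ≤ L) (hf : IsPrimitive L f f') (h : EqOn f g (Icc 0 L))
    (h' : ∀ᵐ t ∂volume.restrict (Ioo 0 L), f' t = g' t) : IsPrimitive L g g' := by
  refine ⟨intervalIntegrable_congr_Ioo hL hf.1 h', fun x hx => ?_⟩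
  rw [← h hx, ← h ⟨le_rfl, hL⟩, hf.2 x hx]
  congr 1
  exact intervalIntegral.integral_congr_ae (ae_Ioo_to_uIoc hx h')

/-- The Leibniz rule holds almost everywhere for absolutely continuous factors. This is the
integration by parts behind every Wronskian identity below, where data are only `L¹`. -/
theorem mul (hL : 0 ≤ L) (hf : IsPrimitive L f f') (hg : IsPrimitive L g g') :
    IsPrimitive L (fun x => f x * g x) (fun x => f' x * g x + f x * g' x) := by
  refine congr hL (of_absolutelyContinuous
    ((hf.absolutelyContinuous hL).fun_mul (hg.absolutelyContinuous hL))) (fun x _ => rfl) ?_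
  filter_upwards [hf.ae_hasDerivAt, hg.ae_hasDerivAt] with x h1 h2
  exact (h1.mul h2).deriv

theorem add (hf : IsPrimitive L f f') (hg : IsPrimitive L g g') :
    IsPrimitive L (fun x => f x + g x) (fun x => f' x + g' x) := by
  refine ⟨hf.1.add hg.1, fun x hx => ?_⟩
  rw [intervalIntegral.integral_add (intervalIntegrable_sub hx hf.1).1
    (intervalIntegrable_sub hx hg.1).1]
  dsimp only
  rw [hf.2 x hx, hg.2 x hx]; ring

theorem const_mul (k : ℝ) (hf : IsPrimitive L f f') :
    IsPrimitive L (fun x => k * f x) (fun x => k * f' x) := by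
  refine ⟨hf.1.const_mul k, fun x hx => ?_⟩
  rw [intervalIntegral.integral_const_mul]
  dsimp only
  rw [hf.2 x hx]; ring

theorem neg (hf : IsPrimitive L f f') :
    IsPrimitive L (fun x => - f x) (fun x => - f' x) := by
  simpa using hf.const_mul (-1)

theorem sub (hf : IsPrimitive L f f') (hg : IsPrimitive L g g') :
    IsPrimitive L (fun x => f x - g x) (fun x => f' x - g' x) := by
  simpa [sub_eq_add_neg] using hf.add hg.neg

theorem of_hasDerivAt (h : ∀ x, HasDerivAt f (f' x) x) (hc : Continuous f') :
    IsPrimitive L f f' := by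
  refine ⟨hc.intervalIntegrable _ _, fun x _ => ?_⟩
  rw [intervalIntegral.integral_eq_sub_of_hasDerivAt (fun t _ => h t) (hc.intervalIntegrable _ _)]
  ring

theorem integral_eq_sub (hL : 0 ≤ L) (hf : IsPrimitive L f f') :
    ∫ t in (0 : ℝ)..L, f' t = f L - f 0 := by
  rw [hf.2 L ⟨hL, le_rfl⟩]; ring

theorem integral_right (hf : IsPrimitive L f f') {x : ℝ} (hx : x ∈ Icc 0 L) :
    ∫ t in x..L, f' t = f L - f x := by
  rw [hf.2 L ⟨hx.1.trans hx.2, le_rfl⟩, hf.2 x hx,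
    ← intervalIntegral.integral_add_adjacent_intervals (intervalIntegrable_sub hx hf.1).1
      (intervalIntegrable_sub hx hf.1).2]
  ring

theorem hasDerivWithinAt (hf : IsPrimitive L f f') (hc : ContinuousOn f' (Icc 0 L))
    {x : ℝ} (hx : x ∈ Icc 0 L) : HasDerivWithinAt f (f' x) (Icc 0 L) x := by
  have : Fact (x ∈ Icc 0 L) := ⟨hx⟩
  have hm : StronglyMeasurableAtFilter f' (𝓝[Icc 0 L] x) volume :=
    hc.stronglyMeasurableAtFilter_nhdsWithin measurableSet_Icc x
  have h1 := (intervalIntegral.integral_hasDerivWithinAt_right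
    (s := Icc 0 L) (t := Icc 0 L) (intervalIntegrable_sub hx hf.1).1 hm (hc x hx)).const_add (f 0)
  exact h1.congr (fun t ht => hf.2 t ht) (hf.2 x hx)

end IsPrimitive

/-! ### `W^{4,1}` as chains of primitives. -/

theorem D_succ {L : ℝ} {k : ℕ} {y : ℝ → ℝ} (x : ℝ) :
    D L (k + 1) y x = derivWithin (D L k y) (Icc 0 L) x := by
  simp [D, iteratedDerivWithin_succ]

theorem D_zero {L : ℝ} {y : ℝ → ℝ} : D L 0 y = y := by
  ext x; simp [D]

theorem derivWithin_eq_deriv_of_mem_Ioo {L x : ℝ} {f : ℝ → ℝ} (hx : x ∈ Ioo 0 L) :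
    derivWithin f (Icc 0 L) x = deriv f x :=
  derivWithin_of_mem_nhds (Icc_mem_nhds hx.1 hx.2)

theorem isPrimitive_D_of_contDiffOn {L : ℝ} (hL : 0 < L) {y : ℝ → ℝ} {n k : ℕ} (hk : k < n)
    (hy : ContDiffOn ℝ n y (Icc 0 L)) : IsPrimitive L (D L k y) (D L (k + 1) y) := by
  have hu := uniqueDiffOn_Icc hL
  have hd : DifferentiableOn ℝ (D L k y) (Icc 0 L) :=
    hy.differentiableOn_iteratedDerivWithin (by exact_mod_cast hk) hu
  have hc : ContinuousOn (D L (k + 1) y) (Icc 0 L) :=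
    hy.continuousOn_iteratedDerivWithin (by exact_mod_cast hk) hu
  refine ⟨intervalIntegrable_of_continuousOn hL.le hc, fun x hx => ?_⟩
  have hsub : Icc 0 x ⊆ Icc 0 L := Icc_subset_Icc_right hx.2
  rw [intervalIntegral.integral_eq_sub_of_hasDerivAt_of_le hx.1 (hd.continuousOn.mono hsub)
    (f' := D L (k + 1) y) ?_ (intervalIntegrable_of_continuousOn hx.1 (hc.mono hsub))]
  · ring
  · intro t ht
    have ht' : t ∈ Ioo 0 L := ⟨ht.1, ht.2.trans_le hx.2⟩
    rw [D_succ]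
    exact (hd t (Ioo_subset_Icc_self ht')).hasDerivWithinAt.hasDerivAt
      (Icc_mem_nhds ht'.1 ht'.2)

theorem MemW41.isPrimitive_three {L : ℝ} (hL : 0 < L) {y : ℝ → ℝ} (hy : MemW41 L y) :
    IsPrimitive L (D L 3 y) (D L 4 y) := by
  refine (IsPrimitive.of_absolutelyContinuous hy.2).congr hL.le (fun _ _ => rfl) ?_
  rw [ae_restrict_Ioo_iff]
  refine Eventually.of_forall fun x hx => ?_
  rw [D_succ, derivWithin_eq_deriv_of_mem_Ioo hx]

theorem D_succ_eqOn {L : ℝ} (hL : 0 < L) {y f f' : ℝ → ℝ} {k : ℕ}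
    (hk : EqOn (D L k y) f (Icc 0 L)) (hf : IsPrimitive L f f') (hc : ContinuousOn f' (Icc 0 L)) :
    EqOn (D L (k + 1) y) f' (Icc 0 L) := by
  intro x hx
  rw [D_succ, derivWithin_congr hk (hk hx)]
  exact (hf.hasDerivWithinAt hc hx).derivWithin (uniqueDiffOn_Icc hL x hx)

/-- A chain of primitives yields an element of `W^{4,1}`. -/
theorem memW41_of_isPrimitive {L : ℝ} (hL : 0 < L) {y y₁ y₂ y₃ y₄ : ℝ → ℝ}
    (h0 : IsPrimitive L y y₁) (h1 : IsPrimitive L y₁ y₂) (h2 : IsPrimitive L y₂ y₃)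
    (h3 : IsPrimitive L y₃ y₄) :
    MemW41 L y ∧ EqOn (D L 2 y) y₂ (Icc 0 L) ∧
      ∀ᵐ x ∂volume.restrict (Ioo 0 L), D L 4 y x = y₄ x := by
  have hu := uniqueDiffOn_Icc hL
  have c1 := h1.continuousOn hL.le
  have c2 := h2.continuousOn hL.le
  have c3 := h3.continuousOn hL.le
  have e0 : EqOn (D L 0 y) y (Icc 0 L) := by rw [D_zero]; exact fun _ _ => rfl
  have e1 := D_succ_eqOn hL e0 h0 c1
  have e2 := D_succ_eqOn hL e1 h1 c2
  have e3 := D_succ_eqOn hL e2 h2 c3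
  have d0 : DifferentiableOn ℝ y (Icc 0 L) := fun x hx =>
    (h0.hasDerivWithinAt c1 hx).differentiableWithinAt
  have d1 : DifferentiableOn ℝ y₁ (Icc 0 L) := fun x hx =>
    (h1.hasDerivWithinAt c2 hx).differentiableWithinAt
  have d2 : DifferentiableOn ℝ y₂ (Icc 0 L) := fun x hx =>
    (h2.hasDerivWithinAt c3 hx).differentiableWithinAt
  refine ⟨⟨?_, ?_⟩, e2, ?_⟩
  · have := (contDiffOn_nat_iff_continuousOn_differentiableOn_deriv (n := 3) (f := y) hu).2
    refine this ⟨fun k hk => ?_, fun k hk => ?_⟩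
    · interval_cases k
      · exact d0.continuousOn.congr e0
      · exact c1.congr e1
      · exact c2.congr e2
      · exact c3.congr e3
    · interval_cases k
      · exact d0.congr e0
      · exact d1.congr e1
      · exact d2.congr e2
  · refine absolutelyContinuousOnInterval_congr ?_ (h3.absolutelyContinuous hL.le)
    rw [uIcc_of_le hL.le]; exact e3.symm
  · have := ae_restrict_Ioo_iff.1 h3.ae_hasDerivAt
    rw [ae_restrict_Ioo_iff]
    filter_upwards [this] with x hx hmem
    rw [D_succ, derivWithin_congr e3 (e3 (Ioo_subset_Icc_self hmem)),
      derivWithin_eq_deriv_of_mem_Ioo hmem, (hx hmem).deriv]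

/-! ### The local operator `-w'' + m² w` and its Green function. -/

/-- The solution of `-e'' = 1`, `e 0 = e L = 0`. -/
noncomputable def bump (L x : ℝ) : ℝ := x * (L - x) / 2

/-- The solution of `-τ'' + m² τ = 1`, `τ 0 = τ L = 0`. -/
noncomputable def tauOne (L m x : ℝ) : ℝ :=
  (1 - Real.cosh (m * (x - L / 2)) / Real.cosh (m * L / 2)) / m ^ 2

/-- The solution of `-q'' + m² q = bump`, `q 0 = q L = 0`. -/
noncomputable def tauBump (L m x : ℝ) : ℝ := (bump L x - tauOne L m x) / m ^ 2

/-- The Green operator of `-w'' + m² w = h`, `w 0 = w L = 0`. -/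
noncomputable def green (L m : ℝ) (h : ℝ → ℝ) (x : ℝ) : ℝ :=
  (Real.sinh (m * x) * (∫ s in x..L, Real.sinh (m * (L - s)) * h s)
    + Real.sinh (m * (L - x)) * ∫ s in (0 : ℝ)..x, Real.sinh (m * s) * h s)
    / (m * Real.sinh (m * L))

theorem hasDerivAt_sinh_mul (m x : ℝ) :
    HasDerivAt (fun x => Real.sinh (m * x)) (m * Real.cosh (m * x)) x := by
  have := ((hasDerivAt_id x).const_mul m).sinh
  simpa [mul_comm] using this

theorem hasDerivAt_cosh_mul (m x : ℝ) :
    HasDerivAt (fun x => Real.cosh (m * x)) (m * Real.sinh (m * x)) x := by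
  have := ((hasDerivAt_id x).const_mul m).cosh
  simpa [mul_comm] using this

theorem hasDerivAt_sinh_mul_sub (L m x : ℝ) :
    HasDerivAt (fun x => Real.sinh (m * (L - x))) (-(m * Real.cosh (m * (L - x)))) x := by
  have := (((hasDerivAt_id x).const_sub L).const_mul m).sinh
  simpa [mul_comm] using this

theorem hasDerivAt_cosh_mul_sub (L m x : ℝ) :
    HasDerivAt (fun x => Real.cosh (m * (L - x))) (-(m * Real.sinh (m * (L - x)))) x := by
  have := (((hasDerivAt_id x).const_sub L).const_mul m).cosh
  simpa [mul_comm] using this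

section prims
variable (L m : ℝ)

theorem prim_sinh : IsPrimitive L (fun x => Real.sinh (m * x)) (fun x => m * Real.cosh (m * x)) :=
  .of_hasDerivAt (hasDerivAt_sinh_mul m) (by fun_prop)

theorem prim_cosh : IsPrimitive L (fun x => Real.cosh (m * x)) (fun x => m * Real.sinh (m * x)) :=
  .of_hasDerivAt (hasDerivAt_cosh_mul m) (by fun_prop)

theorem prim_sinh_sub : IsPrimitive L (fun x => Real.sinh (m * (L - x)))
    (fun x => -(m * Real.cosh (m * (L - x)))) :=
  .of_hasDerivAt (hasDerivAt_sinh_mul_sub L m) (by fun_prop)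

theorem prim_cosh_sub : IsPrimitive L (fun x => Real.cosh (m * (L - x)))
    (fun x => -(m * Real.sinh (m * (L - x)))) :=
  .of_hasDerivAt (hasDerivAt_cosh_mul_sub L m) (by fun_prop)

theorem prim_bump : IsPrimitive L (bump L) (fun x => L / 2 - x) := by
  refine .of_hasDerivAt (fun x => ?_) (by fun_prop)
  have := ((hasDerivAt_id x).mul ((hasDerivAt_id x).const_sub L)).div_const 2
  refine this.congr_deriv ?_
  simp; ring

theorem prim_bump' : IsPrimitive L (fun x => L / 2 - x) (fun _ => -1) :=
  .of_hasDerivAt (fun x => (hasDerivAt_id x).const_sub _) (by fun_prop)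

end prims

theorem sinh_add_identity (L m x : ℝ) :
    Real.sinh (m * x) * Real.cosh (m * (L - x)) + Real.cosh (m * x) * Real.sinh (m * (L - x))
      = Real.sinh (m * L) := by
  rw [← Real.sinh_add]; congr 1; ring

/-- The Wronskians of `w` with `sinh (m x)` and with `sinh (m (L - x))` have derivatives free of
`w`. The first vanishes at `0`, the second at `L`; integrating them over `[0, x]` and `[x, L]` and
eliminating `w' x` gives the formula. -/
theorem eqOn_green {L m : ℝ} (hL : 0 < L) (hm : 0 < m) {h w w' w'' : ℝ → ℝ}
    (h0 : IsPrimitive L w w') (h1 : IsPrimitive L w' w'') (hw0 : w 0 = 0) (hwL : w L = 0)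
    (heq : ∀ᵐ x ∂volume.restrict (Ioo 0 L), w'' x = m ^ 2 * w x - h x) :
    EqOn w (green L m h) (Icc 0 L) := by
  have W1 : IsPrimitive L (fun x => w' x * Real.sinh (m * x) - w x * (m * Real.cosh (m * x)))
      (fun x => -(Real.sinh (m * x) * h x)) := by
    refine ((h1.mul hL.le (prim_sinh L m)).sub
      (h0.mul hL.le ((prim_cosh L m).const_mul m))).congr hL.le (fun _ _ => rfl) ?_
    filter_upwards [heq] with x hx
    rw [hx]; ring
  have W2 : IsPrimitive L
      (fun x => w' x * Real.sinh (m * (L - x)) + w x * (m * Real.cosh (m * (L - x))))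
      (fun x => -(Real.sinh (m * (L - x)) * h x)) := by
    refine ((h1.mul hL.le (prim_sinh_sub L m)).add
      (h0.mul hL.le ((prim_cosh_sub L m).const_mul m))).congr hL.le (fun _ _ => rfl) ?_
    filter_upwards [heq] with x hx
    rw [hx]; ring
  intro x hx
  have e1 := W1.2 x hx
  have e2 := W2.integral_right hx
  simp only [hw0, hwL, mul_zero, sub_self, Real.sinh_zero, zero_mul, intervalIntegral.integral_neg,
    zero_add, add_zero, zero_sub] at e1 e2
  have hs : 0 < Real.sinh (m * L) := Real.sinh_pos_iff.2 (by positivity)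
  rw [green, eq_div_iff (by positivity)]
  have i1 : ∫ s in (0 : ℝ)..x, Real.sinh (m * s) * h s =
      -(w' x * Real.sinh (m * x) - w x * (m * Real.cosh (m * x))) := by linarith
  have i2 : ∫ s in x..L, Real.sinh (m * (L - s)) * h s =
      w' x * Real.sinh (m * (L - x)) + w x * (m * Real.cosh (m * (L - x))) := by linarith
  rw [i1, i2, ← sinh_add_identity L m x]; ring

/-- Variation of parameters with the same two hyperbolic sines. -/
theorem exists_green {L m : ℝ} (hL : 0 < L) (hm : 0 < m) {h : ℝ → ℝ}
    (hh : IntervalIntegrable h volume 0 L) :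
    ∃ w w' : ℝ → ℝ, IsPrimitive L w w' ∧ IsPrimitive L w' (fun x => m ^ 2 * w x - h x) ∧
      w 0 = 0 ∧ w L = 0 := by
  have hs : 0 < Real.sinh (m * L) := Real.sinh_pos_iff.2 (by positivity)
  have hi1 : IntervalIntegrable (fun s => Real.sinh (m * s) * h s) volume 0 L :=
    hh.continuousOn_mul (by fun_prop)
  have hi2 : IntervalIntegrable (fun s => Real.sinh (m * (L - s)) * h s) volume 0 L :=
    hh.continuousOn_mul (by fun_prop)
  set J : ℝ := ∫ s in (0 : ℝ)..L, Real.sinh (m * (L - s)) * h s with hJ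
  let I1 : ℝ → ℝ := fun x => ∫ s in (0 : ℝ)..x, Real.sinh (m * s) * h s
  -- This is the integral over `[x, L]`, rewritten with base point `0` as `IsPrimitive` demands.
  let I2 : ℝ → ℝ := fun x => J - ∫ s in (0 : ℝ)..x, Real.sinh (m * (L - s)) * h s
  have p1 : IsPrimitive L I1 (fun s => Real.sinh (m * s) * h s) :=
    ⟨hi1, fun x _ => by simp [I1]⟩
  have p2 : IsPrimitive L I2 (fun s => -(Real.sinh (m * (L - s)) * h s)) :=
    ⟨hi2.neg, fun x _ => by simp [I2, sub_eq_add_neg]⟩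
  refine ⟨fun x => (m * Real.sinh (m * L))⁻¹ *
      (Real.sinh (m * x) * I2 x + Real.sinh (m * (L - x)) * I1 x),
    fun x => (Real.sinh (m * L))⁻¹ *
      (Real.cosh (m * x) * I2 x - Real.cosh (m * (L - x)) * I1 x), ?_, ?_, ?_, ?_⟩
  · refine ((((prim_sinh L m).mul hL.le p2).add ((prim_sinh_sub L m).mul hL.le p1)).const_mul
      (m * Real.sinh (m * L))⁻¹).congr hL.le (fun _ _ => rfl) (Eventually.of_forall fun x => ?_)
    field_simp
    ring
  · refine ((((prim_cosh L m).mul hL.le p2).sub ((prim_cosh_sub L m).mul hL.le p1)).const_mul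
      (Real.sinh (m * L))⁻¹).congr hL.le (fun _ _ => rfl) (Eventually.of_forall fun x => ?_)
    have := sinh_add_identity L m x
    field_simp
    linear_combination (-(h x)) * this
  · simp [I1]
  · simp [I2, hJ]

theorem integral_mul_le_integral_mul {L : ℝ} {x : ℝ} (hx : x ∈ Icc 0 L) {F G h : ℝ → ℝ}
    (hF : Continuous F) (hG : Continuous G) (hh : IntervalIntegrable h volume 0 L)
    (hpos : ∀ᵐ s ∂volume.restrict (Ioo 0 L), 0 ≤ h s) :
    ((∀ s ∈ Icc 0 x, F s ≤ G s) →
      ∫ s in (0 : ℝ)..x, F s * h s ≤ ∫ s in (0 : ℝ)..x, G s * h s) ∧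
    ((∀ s ∈ Icc x L, F s ≤ G s) → ∫ s in x..L, F s * h s ≤ ∫ s in x..L, G s * h s) := by
  obtain ⟨i1, i2⟩ := intervalIntegrable_sub hx hh
  constructor <;> intro hle
  · refine intervalIntegral.integral_mono_ae_restrict hx.1 (i1.continuousOn_mul hF.continuousOn)
      (i1.continuousOn_mul hG.continuousOn) ?_
    rw [EventuallyLE, ae_restrict_iff' measurableSet_Icc]
    filter_upwards [ae_restrict_Ioo_iff.1 hpos, ae_ne_pt 0, ae_ne_pt L] with s hs h0 h1 hm
    exact mul_le_mul_of_nonneg_right (hle s hm)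
      (hs ⟨lt_of_le_of_ne hm.1 (Ne.symm h0), lt_of_le_of_ne (hm.2.trans hx.2) h1⟩)
  · refine intervalIntegral.integral_mono_ae_restrict hx.2 (i2.continuousOn_mul hF.continuousOn)
      (i2.continuousOn_mul hG.continuousOn) ?_
    rw [EventuallyLE, ae_restrict_iff' measurableSet_Icc]
    filter_upwards [ae_restrict_Ioo_iff.1 hpos, ae_ne_pt 0, ae_ne_pt L] with s hs h0 h1 hm
    exact mul_le_mul_of_nonneg_right (hle s hm)
      (hs ⟨lt_of_le_of_ne (hx.1.trans hm.1) (Ne.symm h0), lt_of_le_of_ne hm.2 h1⟩)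

/-- The Green kernel has a different product form on each side of the diagonal, so the pointwise
kernel bound is taken and integrated on each side separately. -/
theorem mul_integral_le_green {L m k B : ℝ} {Q h : ℝ → ℝ} (hQ : Continuous Q)
    (hh : IntervalIntegrable h volume 0 L)
    (hpos : ∀ᵐ s ∂volume.restrict (Ioo 0 L), 0 ≤ h s) {x : ℝ} (hx : x ∈ Icc 0 L)
    (hright : ∀ s ∈ Icc x L,
      k * Q s ≤ B * (Real.sinh (m * x) * Real.sinh (m * (L - s)) / (m * Real.sinh (m * L))))
    (hleft : ∀ s ∈ Icc 0 x,
      k * Q s ≤ B * (Real.sinh (m * (L - x)) * Real.sinh (m * s) / (m * Real.sinh (m * L)))) :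
    k * ∫ s in (0 : ℝ)..L, Q s * h s ≤ B * green L m h x := by
  obtain ⟨i1, i2⟩ := intervalIntegrable_sub hx hh
  have l := (integral_mul_le_integral_mul hx (F := fun s => k * Q s)
    (G := fun s => B * Real.sinh (m * (L - x)) / (m * Real.sinh (m * L)) * Real.sinh (m * s))
    (by fun_prop) (by fun_prop) hh hpos).1 (fun s hs => (hleft s hs).trans_eq (by ring))
  have r := (integral_mul_le_integral_mul hx (F := fun s => k * Q s)
    (G := fun s => B * Real.sinh (m * x) / (m * Real.sinh (m * L)) * Real.sinh (m * (L - s)))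
    (by fun_prop) (by fun_prop) hh hpos).2 (fun s hs => (hright s hs).trans_eq (by ring))
  simp only [mul_assoc, intervalIntegral.integral_const_mul] at l r
  rw [← intervalIntegral.integral_add_adjacent_intervals (i1.continuousOn_mul hQ.continuousOn)
    (i2.continuousOn_mul hQ.continuousOn), mul_add]
  refine (add_le_add l r).trans_eq ?_
  rw [green]; ring

/-! ### Hyperbolic inequalities. -/

theorem sinh_le_mul_cosh {z : ℝ} (hz : 0 ≤ z) : Real.sinh z ≤ z * Real.cosh z := by
  have hd : ∀ x : ℝ, HasDerivAt (fun x => x * Real.cosh x - Real.sinh x) (x * Real.sinh x) x := by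
    intro x
    refine (((hasDerivAt_id x).mul (Real.hasDerivAt_cosh x)).sub
      (Real.hasDerivAt_sinh x)).congr_deriv ?_
    simp
  have hmono : MonotoneOn (fun x : ℝ => x * Real.cosh x - Real.sinh x) (Ici 0) := by
    refine monotoneOn_of_deriv_nonneg (convex_Ici 0) (by fun_prop)
      (fun x _ => (hd x).differentiableAt.differentiableWithinAt) fun x hx => ?_
    rw [interior_Ici, mem_Ioi] at hx
    rw [(hd x).deriv]
    exact mul_nonneg hx.le (Real.sinh_nonneg_iff.2 hx.le)
  have := hmono (by simp) hz hz
  simpa using this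

/-- In half angles `w = z / 2` this is `sinh w ≤ w cosh w` multiplied by `4 sinh w`. -/
theorem two_mul_cosh_sub_one_le {z : ℝ} (hz : 0 ≤ z) :
    2 * (Real.cosh z - 1) ≤ z * Real.sinh z := by
  have hw : 0 ≤ z / 2 := by positivity
  have h1 := sinh_le_mul_cosh hw
  have hs := Real.sinh_nonneg_iff.2 hw
  have e1 : Real.sinh z = 2 * Real.sinh (z / 2) * Real.cosh (z / 2) := by
    rw [← Real.sinh_two_mul]; congr 1; ring
  have e2 : Real.cosh z = Real.cosh (z / 2) ^ 2 + Real.sinh (z / 2) ^ 2 := by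
    rw [← Real.cosh_two_mul]; congr 1; ring
  have e3 := Real.cosh_sq (z / 2)
  rw [e1, e2, e3]
  nlinarith [mul_le_mul_of_nonneg_left h1 hs]

/-- The expression vanishes at `0`, and by `two_mul_cosh_sub_one_le` its derivative is at least `3 t
(sinh t - t) > 0`. -/
theorem sigma_denom_pos {t : ℝ} (ht : 0 < t) :
    0 < 6 * t * Real.cosh t + 6 * t - 12 * Real.sinh t - t ^ 3 := by
  let f : ℝ → ℝ := fun t => 6 * t * Real.cosh t + 6 * t - 12 * Real.sinh t - t ^ 3
  have hd : ∀ x : ℝ, HasDerivAt f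
      (6 * x * Real.sinh x - 6 * Real.cosh x + 6 - 3 * x ^ 2) x := by
    intro x
    refine ((((((hasDerivAt_id x).const_mul 6).mul (Real.hasDerivAt_cosh x)).add
      ((hasDerivAt_id x).const_mul 6)).sub ((Real.hasDerivAt_sinh x).const_mul 12)).sub
      (hasDerivAt_pow 3 x)).congr_deriv ?_
    simp; ring
  have hmono : StrictMonoOn f (Ici 0) := by
    refine strictMonoOn_of_deriv_pos (convex_Ici 0)
      (fun x _ => (hd x).continuousAt.continuousWithinAt) fun x hx => ?_
    rw [interior_Ici, mem_Ioi] at hx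
    rw [(hd x).deriv]
    have h1 := two_mul_cosh_sub_one_le hx.le
    have h2 := Real.self_lt_sinh_iff.2 hx
    nlinarith [mul_lt_mul_of_pos_left h2 hx]
  have := hmono (by simp) ht.le ht
  simpa [f] using this

theorem tanh_le_self {z : ℝ} (hz : 0 ≤ z) : Real.tanh z ≤ z := by
  rw [Real.tanh_eq_sinh_div_cosh, div_le_iff₀ (Real.cosh_pos z)]
  exact sinh_le_mul_cosh hz

/-! ### The responses `tauOne` and `tauBump`: bounds, integrals, duality. -/

theorem tauOne_eq (L m x : ℝ) : tauOne L m x =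
    (1 - Real.cosh (m * x) + Real.tanh (m * L / 2) * Real.sinh (m * x)) / m ^ 2 := by
  have hc := (Real.cosh_pos (m * L / 2)).ne'
  rw [tauOne, show m * (x - L / 2) = m * x - m * L / 2 by ring, Real.cosh_sub,
    Real.tanh_eq_sinh_div_cosh]
  field_simp
  ring

theorem tauOne_symm (L m x : ℝ) : tauOne L m (L - x) = tauOne L m x := by
  rw [tauOne, tauOne, show m * (L - x - L / 2) = -(m * (x - L / 2)) by ring, Real.cosh_neg]

theorem tauBump_symm (L m x : ℝ) : tauBump L m (L - x) = tauBump L m x := by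
  rw [tauBump, tauBump, tauOne_symm, bump, bump]; ring

theorem tauOne_zero (L m : ℝ) : tauOne L m 0 = 0 := by simp [tauOne_eq]

theorem tauOne_right (L m : ℝ) : tauOne L m L = 0 := by
  have := tauOne_symm L m 0
  rwa [sub_zero, tauOne_zero] at this

theorem bump_nonneg {L x : ℝ} (hx : x ∈ Icc 0 L) : 0 ≤ bump L x := by
  have := mul_nonneg hx.1 (sub_nonneg.2 hx.2)
  rw [bump]; positivity

theorem bump_zero (L : ℝ) : bump L 0 = 0 := by simp [bump]

theorem bump_right (L : ℝ) : bump L L = 0 := by simp [bump]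

theorem bump_le (L x : ℝ) : bump L x ≤ L ^ 2 / 8 := by
  rw [bump]; nlinarith [sq_nonneg (x - L / 2)]

theorem continuous_bump (L : ℝ) : Continuous (bump L) := by unfold bump; fun_prop

theorem continuous_tauOne (L m : ℝ) : Continuous (tauOne L m) := by unfold tauOne; fun_prop

theorem continuous_tauBump (L m : ℝ) : Continuous (tauBump L m) := by
  have := continuous_bump L
  have := continuous_tauOne L m
  unfold tauBump; fun_prop

theorem integral_bump (L : ℝ) : ∫ x in (0 : ℝ)..L, bump L x = L ^ 3 / 12 := by
  rw [intervalIntegral.integral_eq_sub_of_hasDerivAt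
    (f := fun x => L * x ^ 2 / 4 - x ^ 3 / 6)]
  · ring
  · intro x _
    refine ((((hasDerivAt_pow 2 x).const_mul L).div_const 4).sub
      ((hasDerivAt_pow 3 x).div_const 6)).congr_deriv ?_
    simp [bump]; ring
  · exact (continuous_bump L).intervalIntegrable _ _

theorem tauOne_nonneg {L m : ℝ} (hm : 0 < m) {x : ℝ} (hx : x ∈ Icc 0 L) : 0 ≤ tauOne L m x := by
  have hc := Real.cosh_pos (m * L / 2)
  have hL := hx.1.trans hx.2
  have : Real.cosh (m * (x - L / 2)) ≤ Real.cosh (m * L / 2) := by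
    rw [Real.cosh_le_cosh, mul_div_assoc, abs_mul, abs_mul]
    refine mul_le_mul_of_nonneg_left ?_ (abs_nonneg m)
    rw [abs_of_nonneg (by positivity : 0 ≤ L / 2), abs_le]
    constructor <;> linarith [hx.1, hx.2]
  have h2 : Real.cosh (m * (x - L / 2)) / Real.cosh (m * L / 2) ≤ 1 := (div_le_one hc).2 this
  rw [tauOne]
  exact div_nonneg (by linarith) (by positivity)

theorem tauOne_le {L m : ℝ} (x : ℝ) :
    tauOne L m x ≤ Real.tanh (m * L / 2) * Real.sinh (m * x) / m ^ 2 := by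
  rw [tauOne_eq]
  have := Real.one_le_cosh (m * x)
  gcongr
  linarith

/-- The peak, at `L / 2`, is `(1 - 1 / cosh z) / m²` with `z = m L / 2`; `cosh z - 1 ≤ z sinh z`
turns it into the prefactor of `ρ`. -/
theorem tauOne_le_max {L m : ℝ} (hL : 0 < L) (hm : 0 < m) (x : ℝ) :
    tauOne L m x ≤ L * (Real.tanh (m * L / 2) / (2 * m)) := by
  have hc := Real.cosh_pos (m * L / 2)
  have h1 : 1 / Real.cosh (m * L / 2) ≤ Real.cosh (m * (x - L / 2)) / Real.cosh (m * L / 2) := by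
    gcongr
    exact Real.one_le_cosh _
  have h2 := two_mul_cosh_sub_one_le (z := m * L / 2) (by positivity)
  have h3 := Real.one_le_cosh (m * L / 2)
  have h4 : 1 - 1 / Real.cosh (m * L / 2) ≤ m * L / 2 * Real.tanh (m * L / 2) := by
    rw [Real.tanh_eq_sinh_div_cosh, ← mul_div_assoc, one_sub_div hc.ne']
    gcongr
    linarith
  calc tauOne L m x ≤ (m * L / 2 * Real.tanh (m * L / 2)) / m ^ 2 := by
        rw [tauOne]; gcongr; linarith
    _ = _ := by field_simp

/-- The `tanh` terms cancel. With `z = m r`, what remains follows from `2 (cosh z - 1) ≤ z sinh z`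
and `(m L - z) z ≤ (m L - z) sinh z`. -/
theorem tauBump_le {L m : ℝ} (hm : 0 < m) {r : ℝ} (hr : r ∈ Icc 0 L) :
    tauBump L m r ≤ (L / 2 - Real.tanh (m * L / 2) / m) / (m ^ 2 * m) * Real.sinh (m * r) := by
  have hz : 0 ≤ m * r := mul_nonneg hm.le hr.1
  have h2 := two_mul_cosh_sub_one_le hz
  have h3 := Real.self_le_sinh_iff.2 hz
  have h4 : m * r ≤ m * L := mul_le_mul_of_nonneg_left hr.2 hm.le
  have key : m * r * (m * L - m * r) + 2 * (Real.cosh (m * r) - 1) ≤ m * L * Real.sinh (m * r) := by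
    nlinarith [mul_nonneg (sub_nonneg.2 h4) (sub_nonneg.2 h3)]
  rw [tauBump, tauOne_eq, bump, ← sub_nonneg]
  have : (L / 2 - Real.tanh (m * L / 2) / m) / (m ^ 2 * m) * Real.sinh (m * r) -
      (r * (L - r) / 2 - (1 - Real.cosh (m * r) +
        Real.tanh (m * L / 2) * Real.sinh (m * r)) / m ^ 2) / m ^ 2 =
      (m * L * Real.sinh (m * r) - (m * r * (m * L - m * r) + 2 * (Real.cosh (m * r) - 1)))
        / (2 * m ^ 4) := by
    field_simp
    ring
  rw [this]
  exact div_nonneg (by linarith) (by positivity)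

theorem hasDerivAt_tauOne {L m : ℝ} (hm : 0 < m) (x : ℝ) : HasDerivAt (tauOne L m)
    (-(Real.sinh (m * (x - L / 2)) / (m * Real.cosh (m * L / 2)))) x := by
  have hc := Real.cosh_pos (m * L / 2)
  refine (((((((hasDerivAt_id x).sub_const (L / 2)).const_mul m).cosh).div_const
    (Real.cosh (m * L / 2))).const_sub 1).div_const (m ^ 2)).congr_deriv ?_
  simp
  field_simp

theorem hasDerivAt_deriv_tauOne {L m : ℝ} (hm : 0 < m) (x : ℝ) :
    HasDerivAt (fun x => -(Real.sinh (m * (x - L / 2)) / (m * Real.cosh (m * L / 2))))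
      (m ^ 2 * tauOne L m x - 1) x := by
  have hc := Real.cosh_pos (m * L / 2)
  refine (((((hasDerivAt_id x).sub_const (L / 2)).const_mul m).sinh).div_const
    (m * Real.cosh (m * L / 2))).neg.congr_deriv ?_
  simp [tauOne]
  field_simp
  ring

theorem prim_tauOne {L m : ℝ} (hm : 0 < m) : IsPrimitive L (tauOne L m)
    (fun x => -(Real.sinh (m * (x - L / 2)) / (m * Real.cosh (m * L / 2)))) :=
  .of_hasDerivAt (hasDerivAt_tauOne hm) (by fun_prop)

theorem prim_tauOne' {L m : ℝ} (hm : 0 < m) :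
    IsPrimitive L (fun x => -(Real.sinh (m * (x - L / 2)) / (m * Real.cosh (m * L / 2))))
      (fun x => m ^ 2 * tauOne L m x - 1) :=
  .of_hasDerivAt (hasDerivAt_deriv_tauOne hm) (by have := continuous_tauOne L m; fun_prop)

theorem integral_tauBump {L m : ℝ} (hm : 0 < m) : ∫ x in (0 : ℝ)..L, tauBump L m x =
    (L ^ 3 / 12 - (L - 2 * Real.tanh (m * L / 2) / m) / m ^ 2) / m ^ 2 := by
  have hc := Real.cosh_pos (m * L / 2)
  have h1 : ∫ x in (0 : ℝ)..L, tauOne L m x = (L - 2 * Real.tanh (m * L / 2) / m) / m ^ 2 := by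
    rw [intervalIntegral.integral_eq_sub_of_hasDerivAt
      (f := fun x => (-(Real.sinh (m * (x - L / 2)) / (m * Real.cosh (m * L / 2))) + x) / m ^ 2)]
    · rw [show m * (0 - L / 2) = -(m * L / 2) by ring, show m * (L - L / 2) = m * L / 2 by ring,
        Real.sinh_neg, Real.tanh_eq_sinh_div_cosh]
      field_simp
      ring
    · intro x _
      refine (((hasDerivAt_deriv_tauOne hm x).add (hasDerivAt_id x)).div_const _).congr_deriv ?_
      field_simp
      ring
    · exact (continuous_tauOne L m).intervalIntegrable _ _
  simp only [tauBump, intervalIntegral.integral_div]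
  rw [intervalIntegral.integral_sub ((continuous_bump L).intervalIntegrable _ _)
    ((continuous_tauOne L m).intervalIntegrable _ _), integral_bump, h1]

/-- Self-adjointness of `A = -d²/dx² + m²` under Dirichlet conditions: with `bump = A tauBump` and
`h = A v`, both sides are the same pairing. `W` below is the Lagrange identity. -/
theorem integral_bump_mul_eq {L m : ℝ} (hL : 0 < L) (hm : 0 < m) {v v' v'' h : ℝ → ℝ}
    (h0 : IsPrimitive L v v') (h1 : IsPrimitive L v' v'') (hv0 : v 0 = 0) (hvL : v L = 0)
    (hh : IntervalIntegrable h volume 0 L)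
    (heq : ∀ᵐ x ∂volume.restrict (Ioo 0 L), v'' x = m ^ 2 * v x - h x) :
    ∫ x in (0 : ℝ)..L, bump L x * v x = ∫ x in (0 : ℝ)..L, tauBump L m x * h x := by
  have q0 : IsPrimitive L (tauBump L m) (fun x => (m ^ 2)⁻¹ * ((L / 2 - x) -
      -(Real.sinh (m * (x - L / 2)) / (m * Real.cosh (m * L / 2))))) :=
    (((prim_bump L).sub (prim_tauOne hm)).const_mul (m ^ 2)⁻¹).congr hL.le
      (fun x _ => by simp only [tauBump]; ring) (Eventually.of_forall fun _ => rfl)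
  have q1 := ((prim_bump' L).sub (prim_tauOne' (L := L) hm)).const_mul (m ^ 2)⁻¹
  have hq0 : tauBump L m 0 = 0 := by simp [tauBump, bump_zero, tauOne_zero]
  have hqL : tauBump L m L = 0 := by simp [tauBump, bump_right, tauOne_right]
  have W : IsPrimitive L (fun x => v' x * tauBump L m x - v x * ((m ^ 2)⁻¹ * ((L / 2 - x) -
      -(Real.sinh (m * (x - L / 2)) / (m * Real.cosh (m * L / 2))))))
      (fun x => bump L x * v x - tauBump L m x * h x) := by
    refine ((h1.mul hL.le q0).sub (h0.mul hL.le q1)).congr hL.le (fun _ _ => rfl) ?_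
    filter_upwards [heq] with x hx
    rw [hx, tauBump]
    field_simp
    ring
  have := W.integral_eq_sub hL.le
  rw [intervalIntegral.integral_sub] at this
  · simp only [hq0, hqL, hv0, hvL, mul_zero, zero_mul, sub_self] at this
    linarith
  · exact intervalIntegrable_of_continuousOn hL.le
      ((continuous_bump L).continuousOn.mul (h0.continuousOn hL.le))
  · exact hh.continuousOn_mul (continuous_tauBump L m).continuousOn

theorem integral_bump_mul_tauOne {L m : ℝ} (hL : 0 < L) (hm : 0 < m) :
    ∫ x in (0 : ℝ)..L, bump L x * tauOne L m x = ∫ x in (0 : ℝ)..L, tauBump L m x := by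
  have := integral_bump_mul_eq hL hm (prim_tauOne (L := L) hm) (prim_tauOne' hm) (tauOne_zero L m)
    (tauOne_right L m) (h := fun _ => 1) (continuous_const.intervalIntegrable _ _)
    (Eventually.of_forall fun _ => rfl)
  simpa using this

theorem integral_bump_mul_nonneg {L : ℝ} (hL : 0 < L) {v : ℝ → ℝ}
    (hv : ∀ x ∈ Icc 0 L, 0 ≤ v x) : 0 ≤ ∫ x in (0 : ℝ)..L, bump L x * v x :=
  intervalIntegral.integral_nonneg hL.le fun x hx => mul_nonneg (bump_nonneg hx) (hv x hx)

/-! ### The nonlocal linear problem and its comparison principle. -/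

/-- The explicit bound on `N` gives the positivity constant of the Green kernel. -/
theorem kernel_constant_le {L m N : ℝ} (hL : 0 < L) (hm : 0 < m)
    (hN : N ≤ 4 * m ^ 2 / L ^ 3 * sigma (m * L)) :
    N * (Real.tanh (m * L / 2) / m ^ 2 *
        ((L / 2 - Real.tanh (m * L / 2) / m) / (m ^ 2 * m))) ≤
      (1 + N * ∫ x in (0 : ℝ)..L, tauBump L m x) / (m * Real.sinh (m * L)) := by
  have hden := sigma_denom_pos (t := m * L) (by positivity)
  have hs : 0 < Real.sinh (m * L) := Real.sinh_pos_iff.2 (by positivity)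
  have hc := Real.cosh_pos (m * L / 2)
  have h1 : N * (6 * (m * L) * Real.cosh (m * L) + 6 * (m * L) - 12 * Real.sinh (m * L)
      - (m * L) ^ 3) ≤ 12 * m ^ 5 := by
    calc _ ≤ 4 * m ^ 2 / L ^ 3 * sigma (m * L) * _ := mul_le_mul_of_nonneg_right hN hden.le
      _ = 12 * m ^ 5 := by
        rw [sigma, mul_assoc, div_mul_cancel₀ _ hden.ne']
        field_simp
        ring
  rw [le_div_iff₀ (by positivity), integral_tauBump hm]
  have e1 : Real.sinh (m * L) = 2 * Real.sinh (m * L / 2) * Real.cosh (m * L / 2) := by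
    rw [← Real.sinh_two_mul]; congr 1; ring
  have e2 : Real.cosh (m * L) = Real.cosh (m * L / 2) ^ 2 + Real.sinh (m * L / 2) ^ 2 := by
    rw [← Real.cosh_two_mul]; congr 1; ring
  have e3 := Real.sinh_sq (m * L / 2)
  rw [e1, e2] at h1
  rw [e1, Real.tanh_eq_sinh_div_cosh]
  set S := Real.sinh (m * L / 2)
  set C := Real.cosh (m * L / 2)
  have h2 : N * ((12 * (m * L) * C ^ 2 - 24 * S * C - (m * L) ^ 3) / (12 * m ^ 5)) ≤ 1 := by
    rw [← mul_div_assoc, div_le_one (by positivity)]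
    refine le_trans (le_of_eq ?_) h1
    rw [e3]; ring
  have h3 : S / C / m ^ 2 * ((L / 2 - S / C / m) / (m ^ 2 * m)) * (m * (2 * S * C)) -
      (L ^ 3 / 12 - (L - 2 * (S / C) / m) / m ^ 2) / m ^ 2 =
      (12 * (m * L) * C ^ 2 - 24 * S * C - (m * L) ^ 3) / (12 * m ^ 5) := by
    -- The identity holds only modulo `S² = C² - 1`; the last summand makes explicit the multiple of
    -- that relation which is needed.
    have : S / C / m ^ 2 * ((L / 2 - S / C / m) / (m ^ 2 * m)) * (m * (2 * S * C)) -
        (L ^ 3 / 12 - (L - 2 * (S / C) / m) / m ^ 2) / m ^ 2 =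
        (12 * (m * L) * C ^ 2 - 24 * S * C - (m * L) ^ 3) / (12 * m ^ 5) +
        (L / m ^ 4 - 2 * S / (C * m ^ 5)) * (S ^ 2 - (C ^ 2 - 1)) := by
      field_simp
      ring
    rw [this, e3]; ring
  rw [← h3] at h2
  linarith

/-- `u` solves `-u'' + m² u + N ∫₀ᴸ bump u = h`, `u 0 = u L = 0`; this is the linear problem for
`u = -y''`. -/
def IsLinSol (L m N : ℝ) (h u : ℝ → ℝ) : Prop :=
  ∃ u' : ℝ → ℝ, IsPrimitive L u u' ∧
    IsPrimitive L u' (fun x => m ^ 2 * u x + N * (∫ t in (0 : ℝ)..L, bump L t * u t) - h x) ∧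
    u 0 = 0 ∧ u L = 0

theorem integral_bump_mul_add {L : ℝ} (hL : 0 ≤ L) (k : ℝ) {u v : ℝ → ℝ}
    (hu : ContinuousOn u (Icc 0 L)) (hv : ContinuousOn v (Icc 0 L)) :
    ∫ t in (0 : ℝ)..L, bump L t * (u t + k * v t) =
      (∫ t in (0 : ℝ)..L, bump L t * u t) + k * ∫ t in (0 : ℝ)..L, bump L t * v t := by
  rw [← intervalIntegral.integral_const_mul, ← intervalIntegral.integral_add]
  · congr 1; ext t; ring
  · exact intervalIntegrable_of_continuousOn hL ((continuous_bump L).continuousOn.mul hu)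
  · exact (intervalIntegrable_of_continuousOn hL
      ((continuous_bump L).continuousOn.mul hv)).const_mul k

namespace IsLinSol

variable {L m N : ℝ} {h g u v : ℝ → ℝ}

theorem continuousOn (hL : 0 < L) (hu : IsLinSol L m N h u) : ContinuousOn u (Icc 0 L) := by
  obtain ⟨u', h0, -⟩ := hu
  exact h0.continuousOn hL.le

theorem intervalIntegrable (hL : 0 < L) (hu : IsLinSol L m N h u) :
    IntervalIntegrable h volume 0 L := by
  have hc := hu.continuousOn hL
  obtain ⟨u', h0, h1, -⟩ := hu
  have : IntervalIntegrable
      (fun x => m ^ 2 * u x + N * (∫ t in (0 : ℝ)..L, bump L t * u t)) volume 0 L :=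
    intervalIntegrable_of_continuousOn hL.le (by fun_prop)
  simpa using this.sub h1.1

theorem add_const_mul (hL : 0 < L) (k : ℝ) (hu : IsLinSol L m N h u) (hv : IsLinSol L m N g v) :
    IsLinSol L m N (fun x => h x + k * g x) (fun x => u x + k * v x) := by
  have e := integral_bump_mul_add hL.le k (hu.continuousOn hL) (hv.continuousOn hL)
  obtain ⟨u', h0, h1, hu0, huL⟩ := hu
  obtain ⟨v', g0, g1, hv0, hvL⟩ := hv
  refine ⟨_, h0.add (g0.const_mul k), ?_, by simp [hu0, hv0], by simp [huL, hvL]⟩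
  refine (h1.add (g1.const_mul k)).congr hL.le (fun _ _ => rfl) (Eventually.of_forall fun x => ?_)
  rw [e]; ring

theorem sub (hL : 0 < L) (hu : IsLinSol L m N h u) (hv : IsLinSol L m N g v) :
    IsLinSol L m N (fun x => h x - g x) (fun x => u x - v x) := by
  simpa [sub_eq_add_neg] using hu.add_const_mul hL (-1) hv

theorem congr (hL : 0 < L) (hu : IsLinSol L m N h u) (huv : EqOn u v (Icc 0 L))
    (hg : ∀ᵐ x ∂volume.restrict (Ioo 0 L), h x = g x) : IsLinSol L m N g v := by
  have e : ∫ t in (0 : ℝ)..L, bump L t * u t = ∫ t in (0 : ℝ)..L, bump L t * v t :=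
    intervalIntegral.integral_congr fun t ht => by
      rw [uIcc_of_le hL.le] at ht
      simp only [huv ht]
  obtain ⟨u', h0, h1, hu0, huL⟩ := hu
  refine ⟨u', h0.congr hL.le huv (Eventually.of_forall fun _ => rfl),
    h1.congr hL.le (fun _ _ => rfl) ?_, ?_, ?_⟩
  · filter_upwards [hg, ae_of_forall_Icc huv] with x hx hx'
    rw [hx, hx', e]
  · rw [← huv ⟨le_rfl, hL.le⟩, hu0]
  · rw [← huv ⟨hL.le, le_rfl⟩, huL]

end IsLinSol

theorem isLinSol_tauOne {L m : ℝ} (N : ℝ) (hL : 0 < L) (hm : 0 < m) :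
    IsLinSol L m N (fun _ => 1 + N * ∫ t in (0 : ℝ)..L, bump L t * tauOne L m t) (tauOne L m) :=
  ⟨_, prim_tauOne hm, (prim_tauOne' hm).congr hL.le (fun _ _ => rfl)
    (Eventually.of_forall fun x => by ring), tauOne_zero L m, tauOne_right L m⟩

theorem one_add_integral_pos {L m N : ℝ} (hL : 0 < L) (hm : 0 < m) (hN : 0 < N) :
    0 < 1 + N * ∫ t in (0 : ℝ)..L, bump L t * tauOne L m t := by
  have := integral_bump_mul_nonneg hL (fun x hx => tauOne_nonneg hm hx)
  positivity

/-- Rank-one correction: the local solution `w` has nonlocal defect `N K`, a constant, and `tauOne`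
produces the positive constant `1 + N C`, so a multiple of it cancels the defect. -/
theorem exists_isLinSol {L m N : ℝ} (hL : 0 < L) (hm : 0 < m) (hN : 0 < N) {h : ℝ → ℝ}
    (hh : IntervalIntegrable h volume 0 L) : ∃ u, IsLinSol L m N h u := by
  obtain ⟨w, w', h0, h1, hw0, hwL⟩ := exists_green hL hm hh
  set K := ∫ t in (0 : ℝ)..L, bump L t * w t
  have hsol : IsLinSol L m N (fun x => h x + N * K) w :=
    ⟨w', h0, h1.congr hL.le (fun _ _ => rfl) (Eventually.of_forall fun x => by ring), hw0, hwL⟩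
  have hpos := one_add_integral_pos hL hm hN
  refine ⟨_, (hsol.add_const_mul hL
    (-(N * K) / (1 + N * ∫ t in (0 : ℝ)..L, bump L t * tauOne L m t)) (isLinSol_tauOne N hL hm)).congr hL (fun _ _ => rfl) (Eventually.of_forall fun x => ?_)⟩
  rw [div_mul_cancel₀ _ hpos.ne']
  ring

/-- Comparison principle for the linear problem. -/
theorem IsLinSol.nonneg {L m N : ℝ} (hL : 0 < L) (hm : 0 < m) (hN : 0 < N)
    (hMN : N ≤ 4 * m ^ 2 / L ^ 3 * sigma (m * L)) {h u : ℝ → ℝ} (hu : IsLinSol L m N h u)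
    (hpos : ∀ᵐ x ∂volume.restrict (Ioo 0 L), 0 ≤ h x) : ∀ x ∈ Icc 0 L, 0 ≤ u x := by
  intro x hx
  have hh := hu.intervalIntegrable hL
  set K := ∫ t in (0 : ℝ)..L, bump L t * u t with hK
  -- Adding `N K τ` absorbs the nonlocal term: `v = u + N K τ` solves the local problem with the
  -- original `h`, and `∫ bump · v = (1 + N C) K`.
  have hv := hu.add_const_mul hL (N * K) (isLinSol_tauOne N hL hm)
  have eK := integral_bump_mul_add hL.le (N * K) (hu.continuousOn hL)
    (continuous_tauOne L m).continuousOn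
  set C := ∫ t in (0 : ℝ)..L, bump L t * tauOne L m t with hC
  have hCpos : 0 < 1 + N * C := one_add_integral_pos hL hm hN
  obtain ⟨v', h0, h1, hv0, hvL⟩ := hv
  have heq : ∀ᵐ x ∂volume.restrict (Ioo 0 L), m ^ 2 * (u x + N * K * tauOne L m x) +
      N * (∫ t in (0 : ℝ)..L, bump L t * (u t + N * K * tauOne L m t)) -
      (h x + N * K * (1 + N * C)) = m ^ 2 * (u x + N * K * tauOne L m x) - h x := by
    refine Eventually.of_forall fun x => ?_
    rw [eK, ← hK]; ring
  have hgreen := eqOn_green hL hm h0 h1 hv0 hvL heq hx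
  have hint := integral_bump_mul_eq hL hm h0 h1 hv0 hvL hh heq
  rw [eK, ← hK] at hint
  have hconst := kernel_constant_le hL hm hMN
  rw [← integral_bump_mul_tauOne hL hm, ← hC] at hconst
  have hκ : 0 ≤ (L / 2 - Real.tanh (m * L / 2) / m) / (m ^ 2 * m) := by
    have h1 := tanh_le_self (z := m * L / 2) (by positivity)
    have : Real.tanh (m * L / 2) / m ≤ L / 2 := by
      rw [div_le_iff₀ hm]; linarith
    exact div_nonneg (by linarith) (by positivity)
  -- Nonnegativity of the kernel of the nonlocal problem for `s ≥ x`. For `s ≤ x` it is used at the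
  -- reflected points `L - x`, `L - s`, as `τ` and `q` are symmetric.
  have pointwise : ∀ x ∈ Icc 0 L, ∀ s ∈ Icc 0 L, N * tauOne L m x * tauBump L m s ≤
      (1 + N * C) * (Real.sinh (m * x) * Real.sinh (m * (L - s)) / (m * Real.sinh (m * L))) := by
    intro x hx s hs
    have hs' : L - s ∈ Icc 0 L := ⟨by linarith [hs.2], by linarith [hs.1]⟩
    have b1 := tauOne_le (L := L) (m := m) x
    have b2 := tauBump_le hm hs'
    rw [tauBump_symm] at b2
    have s1 : 0 ≤ Real.sinh (m * x) := Real.sinh_nonneg_iff.2 (mul_nonneg hm.le hx.1)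
    have s2 : 0 ≤ Real.sinh (m * (L - s)) := Real.sinh_nonneg_iff.2 (mul_nonneg hm.le hs'.1)
    calc N * tauOne L m x * tauBump L m s = N * (tauOne L m x * tauBump L m s) := by ring
      _ ≤ N * (Real.tanh (m * L / 2) * Real.sinh (m * x) / m ^ 2 *
          ((L / 2 - Real.tanh (m * L / 2) / m) / (m ^ 2 * m) * Real.sinh (m * (L - s)))) :=
        mul_le_mul_of_nonneg_left (mul_le_mul_of_nonneg b1 b2 (tauOne_nonneg hm hx)
          (mul_nonneg hκ s2)) hN.le
      _ = N * (Real.tanh (m * L / 2) / m ^ 2 *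
        ((L / 2 - Real.tanh (m * L / 2) / m) / (m ^ 2 * m))) *
          (Real.sinh (m * x) * Real.sinh (m * (L - s))) := by ring
      _ ≤ (1 + N * C) / (m * Real.sinh (m * L)) *
          (Real.sinh (m * x) * Real.sinh (m * (L - s))) :=
        mul_le_mul_of_nonneg_right hconst (mul_nonneg s1 s2)
      _ = _ := by ring
  have key := mul_integral_le_green (k := N * tauOne L m x) (B := 1 + N * C) (m := m)
    (continuous_tauBump L m) hh hpos hx
    (fun s hs => pointwise x hx s ⟨hx.1.trans hs.1, hs.2⟩)
    (fun s hs => by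
      have := pointwise (L - x) ⟨by linarith [hx.2], by linarith [hx.1]⟩ (L - s)
        ⟨by linarith [hs.2, hx.2], by linarith [hs.1]⟩
      rwa [tauOne_symm, tauBump_symm, sub_sub_cancel] at this)
  rw [← hint, ← hgreen] at key
  have : 0 ≤ (1 + N * C) * u x := by linarith
  exact nonneg_of_mul_nonneg_right this hCpos

theorem IsLinSol.mono {L m N : ℝ} (hL : 0 < L) (hm : 0 < m) (hN : 0 < N)
    (hMN : N ≤ 4 * m ^ 2 / L ^ 3 * sigma (m * L)) {h g u v : ℝ → ℝ} (hu : IsLinSol L m N h u)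
    (hv : IsLinSol L m N g v) (hle : ∀ᵐ x ∂volume.restrict (Ioo 0 L), h x ≤ g x) :
    ∀ x ∈ Icc 0 L, u x ≤ v x := by
  intro x hx
  refine sub_nonneg.1 ((hv.sub hL hu).nonneg hL hm hN hMN ?_ x hx)
  filter_upwards [hle] with x hx using sub_nonneg.2 hx

/-- `H τ` has right-hand side `H (1 + N C) ≥ H`, so it is a barrier for both `u` and `-u`. -/
theorem IsLinSol.abs_le {L m N : ℝ} (hL : 0 < L) (hm : 0 < m) (hN : 0 < N)
    (hMN : N ≤ 4 * m ^ 2 / L ^ 3 * sigma (m * L)) {h u : ℝ → ℝ} (hu : IsLinSol L m N h u)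
    {H : ℝ} (hH : 0 ≤ H) (hh : ∀ᵐ x ∂volume.restrict (Ioo 0 L), |h x| ≤ H) :
    ∀ x ∈ Icc 0 L, |u x| ≤ L * (Real.tanh (m * L / 2) / (2 * m)) * H := by
  intro x hx
  have hC := integral_bump_mul_nonneg hL (fun x hx => tauOne_nonneg hm hx)
  have hτ := isLinSol_tauOne N hL hm
  set C := ∫ t in (0 : ℝ)..L, bump L t * tauOne L m t
  have hNC : 0 ≤ N * C := by positivity
  have hle : H ≤ H * (1 + N * C) := le_mul_of_one_le_right hH (by linarith)
  -- The zero solution of the zero problem, in a form to which multiples of `τ` and of `u` can be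
  -- added.
  have hzero : IsLinSol L m N (fun x => h x - h x) (fun x => u x - u x) := hu.sub hL hu
  have hz := (hzero.add_const_mul hL H hτ)
  have h1 := hu.mono hL hm hN hMN hz (by
    filter_upwards [hh] with t ht
    have := le_abs_self (h t)
    linarith) x hx
  have h2 := ((hzero.add_const_mul hL (-1) hu)).mono hL hm hN hMN hz (by
    filter_upwards [hh] with t ht
    have := neg_abs_le (h t)
    linarith) x hx
  have h3 := mul_le_mul_of_nonneg_left (tauOne_le_max hL hm x) hH
  rw [_root_.abs_le]
  constructor <;> linarith

/-! ### Passing between `y` and `u = -y''`. -/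

/-- `y` is `C²` on `[0, L]` and vanishes at the end points. -/
def IsC2Dirichlet (L : ℝ) (y : ℝ → ℝ) : Prop :=
  ContDiffOn ℝ 2 y (Icc 0 L) ∧ y 0 = 0 ∧ y L = 0

/-- Green's formula `L z(x) = (L - x) ∫₀ˣ t (-z'') + x ∫ₓᴸ (L - t) (-z'')`, obtained from the
Wronskians of `z` with `x` and `L - x`. -/
theorem nonneg_of_isPrimitive {L : ℝ} (hL : 0 < L) {z z' z'' : ℝ → ℝ} (h0 : IsPrimitive L z z')
    (h1 : IsPrimitive L z' z'') (hz0 : z 0 = 0) (hzL : z L = 0)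
    (hneg : ∀ x ∈ Icc 0 L, z'' x ≤ 0) : ∀ x ∈ Icc 0 L, 0 ≤ z x := by
  have p1 : IsPrimitive L (fun x => x) (fun _ => 1) :=
    .of_hasDerivAt (fun x => hasDerivAt_id x) continuous_const
  have p2 : IsPrimitive L (fun x => L - x) (fun _ => -1) :=
    .of_hasDerivAt (fun x => (hasDerivAt_id x).const_sub L) continuous_const
  have W1 : IsPrimitive L (fun x => z' x * x - z x) (fun x => x * z'' x) :=
    ((h1.mul hL.le p1).sub h0).congr hL.le (fun _ _ => rfl)
      (Eventually.of_forall fun x => by ring)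
  have W2 : IsPrimitive L (fun x => z' x * (L - x) + z x) (fun x => (L - x) * z'' x) :=
    ((h1.mul hL.le p2).add h0).congr hL.le (fun _ _ => rfl)
      (Eventually.of_forall fun x => by ring)
  intro x hx
  have e1 := W1.2 x hx
  have e2 := W2.integral_right hx
  simp only [hz0, hzL, mul_zero, sub_self, zero_add, add_zero, zero_sub] at e1 e2
  have i1 : 0 ≤ ∫ t in (0 : ℝ)..x, -(t * z'' t) :=
    intervalIntegral.integral_nonneg hx.1 fun t ht => by
      nlinarith [hneg t ⟨ht.1, ht.2.trans hx.2⟩, ht.1]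
  have i2 : 0 ≤ ∫ t in x..L, -((L - t) * z'' t) :=
    intervalIntegral.integral_nonneg hx.2 fun t ht => by
      nlinarith [hneg t ⟨hx.1.trans ht.1, ht.2⟩, ht.2]
  rw [intervalIntegral.integral_neg, ← e1] at i1
  rw [intervalIntegral.integral_neg, e2] at i2
  have : 0 ≤ L * z x := by
    nlinarith [mul_nonneg hx.1 i2, mul_nonneg (sub_nonneg.2 hx.2) i1]
  exact nonneg_of_mul_nonneg_right this hL

/-- `δ · bump ± z` has nonpositive second derivative, so `|z| ≤ δ · bump ≤ δ L² / 8`; the stated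
constant is twice that. -/
theorem abs_le_of_isPrimitive {L δ : ℝ} (hL : 0 < L) {z z' z'' : ℝ → ℝ}
    (h0 : IsPrimitive L z z') (h1 : IsPrimitive L z' z'') (hz0 : z 0 = 0) (hzL : z L = 0)
    (hδ : ∀ x ∈ Icc 0 L, |z'' x| ≤ δ) : ∀ x ∈ Icc 0 L, |z x| ≤ L ^ 2 / 4 * δ := by
  have hδ0 : 0 ≤ δ := (abs_nonneg _).trans (hδ 0 ⟨le_rfl, hL.le⟩)
  have b0 := (prim_bump L).const_mul δ
  have b1 := (prim_bump' L).const_mul δ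
  intro x hx
  have l := nonneg_of_isPrimitive hL (b0.add h0) (b1.add h1) (by simp [bump_zero, hz0])
    (by simp [bump_right, hzL]) (fun t ht => by linarith [le_abs_self (z'' t), hδ t ht]) x hx
  have r := nonneg_of_isPrimitive hL (b0.sub h0) (b1.sub h1) (by simp [bump_zero, hz0])
    (by simp [bump_right, hzL]) (fun t ht => by linarith [neg_abs_le (z'' t), hδ t ht]) x hx
  have : δ * bump L x ≤ L ^ 2 / 4 * δ := by
    nlinarith [mul_le_mul_of_nonneg_left (bump_le L x) hδ0, sq_nonneg L]
  rw [abs_le]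
  constructor <;> linarith

namespace IsC2Dirichlet

variable {L : ℝ} {y z : ℝ → ℝ}

theorem prim_zero (hL : 0 < L) (hy : IsC2Dirichlet L y) : IsPrimitive L y (D L 1 y) := by
  have := isPrimitive_D_of_contDiffOn hL (n := 2) (k := 0) (by norm_num) hy.1
  rwa [D_zero] at this

theorem prim_one (hL : 0 < L) (hy : IsC2Dirichlet L y) : IsPrimitive L (D L 1 y) (D L 2 y) :=
  isPrimitive_D_of_contDiffOn hL (n := 2) (k := 1) (by norm_num) hy.1

theorem continuousOn_D2 (hL : 0 < L) (hy : IsC2Dirichlet L y) :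
    ContinuousOn (D L 2 y) (Icc 0 L) :=
  hy.1.continuousOn_iteratedDerivWithin (by norm_num) (uniqueDiffOn_Icc hL)

theorem integral_eq (hL : 0 < L) (hy : IsC2Dirichlet L y) :
    ∫ t in (0 : ℝ)..L, y t = ∫ t in (0 : ℝ)..L, bump L t * (-D L 2 y t) := by
  have h0 := hy.prim_zero hL
  have h1 := hy.prim_one hL
  have W : IsPrimitive L (fun x => D L 1 y x * bump L x - y x * (L / 2 - x))
      (fun x => y x - bump L x * (-D L 2 y x)) :=
    ((h1.mul hL.le (prim_bump L)).sub (h0.mul hL.le (prim_bump' L))).congr hL.le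
      (fun _ _ => rfl) (Eventually.of_forall fun x => by ring)
  have := W.integral_eq_sub hL.le
  have hi : IntervalIntegrable (fun t => bump L t * (-D L 2 y t)) volume 0 L :=
    intervalIntegrable_of_continuousOn hL.le
      ((continuous_bump L).continuousOn.mul (hy.continuousOn_D2 hL).neg)
  rw [intervalIntegral.integral_sub
    (intervalIntegrable_of_continuousOn hL.le (h0.continuousOn hL.le)) hi] at this
  simp only [bump_zero, bump_right, hy.2.1, hy.2.2, mul_zero, zero_mul, sub_self] at this
  linarith

theorem below (hL : 0 < L) (hy : IsC2Dirichlet L y) (hz : IsC2Dirichlet L z)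
    (h : ∀ x ∈ Icc 0 L, -D L 2 y x ≤ -D L 2 z x) : Below L y z := fun x hx =>
  ⟨sub_nonneg.1 (nonneg_of_isPrimitive hL ((hz.prim_zero hL).sub (hy.prim_zero hL))
    ((hz.prim_one hL).sub (hy.prim_one hL)) (by simp [hy.2.1, hz.2.1]) (by simp [hy.2.2, hz.2.2])
    (fun t ht => by linarith [h t ht]) x hx), by linarith [h x hx]⟩

theorem abs_sub_le (hL : 0 < L) (hy : IsC2Dirichlet L y) (hz : IsC2Dirichlet L z) {δ : ℝ}
    (h : ∀ x ∈ Icc 0 L, |D L 2 y x - D L 2 z x| ≤ δ) :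
    ∀ x ∈ Icc 0 L, |y x - z x| ≤ L ^ 2 / 4 * δ :=
  abs_le_of_isPrimitive hL ((hy.prim_zero hL).sub (hz.prim_zero hL))
    ((hy.prim_one hL).sub (hz.prim_one hL)) (by simp [hy.2.1, hz.2.1]) (by simp [hy.2.2, hz.2.2]) h

theorem of_memW41 (hy : MemW41 L y) (hbc : NavierBC L y) : IsC2Dirichlet L y :=
  ⟨hy.1.of_le (by norm_num), hbc.1, hbc.2.1⟩

end IsC2Dirichlet

theorem isLinSol_of_linOp {L m N : ℝ} (hL : 0 < L) {y h : ℝ → ℝ} (hy : MemW41 L y)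
    (hbc : NavierBC L y) (heq : ∀ᵐ x ∂volume.restrict (Ioo 0 L), linOp L (m ^ 2) N y x = h x) :
    IsLinSol L m N h (fun x => -D L 2 y x) := by
  refine ⟨fun x => -D L 3 y x,
    (isPrimitive_D_of_contDiffOn hL (n := 3) (k := 2) (by norm_num) hy.1).neg,
    (hy.isPrimitive_three hL).neg.congr hL.le (fun _ _ => rfl) ?_, by simp [hbc.2.2.1],
    by simp [hbc.2.2.2]⟩
  have hi := (IsC2Dirichlet.of_memW41 hy hbc).integral_eq hL
  filter_upwards [heq] with x hx
  rw [← hx, linOp, hi]; ring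

/-- Integrate `u` twice, change sign, and add the linear function that restores the value `0` at
`L`. -/
theorem exists_of_isLinSol {L m N : ℝ} (hL : 0 < L) {u h : ℝ → ℝ} (hu : IsLinSol L m N h u) :
    ∃ y, MemW41 L y ∧ NavierBC L y ∧ EqOn (D L 2 y) (fun x => -u x) (Icc 0 L) ∧
      ∀ᵐ x ∂volume.restrict (Ioo 0 L), linOp L (m ^ 2) N y x = h x := by
  have hc := hu.continuousOn hL
  obtain ⟨u', h0, h1, hu0, huL⟩ := hu
  let P : ℝ → ℝ := fun x => ∫ t in (0 : ℝ)..x, u t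
  have pP : IsPrimitive L P u :=
    ⟨intervalIntegrable_of_continuousOn hL.le hc, fun x _ => by simp [P]⟩
  let Q : ℝ → ℝ := fun x => ∫ t in (0 : ℝ)..x, P t
  have pQ : IsPrimitive L Q P :=
    ⟨intervalIntegrable_of_continuousOn hL.le (pP.continuousOn hL.le), fun x _ => by simp [Q]⟩
  have p0 : IsPrimitive L (fun x => Q L / L * x - Q x) (fun x => Q L / L - P x) := by
    refine IsPrimitive.sub (.of_hasDerivAt (fun x => ?_) continuous_const) pQ
    simpa using (hasDerivAt_id x).const_mul (Q L / L)
  have p1 : IsPrimitive L (fun x => Q L / L - P x) (fun x => -u x) := by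
    have : IsPrimitive L (fun _ => Q L / L) (fun _ => 0) :=
      .of_hasDerivAt (fun x => hasDerivAt_const x _) continuous_const
    simpa using this.sub pP
  obtain ⟨hW, h2, h4⟩ := memW41_of_isPrimitive hL p0 p1 h0.neg h1.neg
  have hbc : NavierBC L (fun x => Q L / L * x - Q x) := by
    refine ⟨by simp [Q], by field_simp; ring, ?_, ?_⟩
    · simp [h2 ⟨le_rfl, hL.le⟩, hu0]
    · simp [h2 ⟨hL.le, le_rfl⟩, huL]
  refine ⟨_, hW, hbc, h2, ?_⟩
  have hi := (IsC2Dirichlet.of_memW41 hW hbc).integral_eq hL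
  have hi' : ∫ t in (0 : ℝ)..L, bump L t * (-D L 2 (fun x => Q L / L * x - Q x) t) =
      ∫ t in (0 : ℝ)..L, bump L t * u t :=
    integral_congr_Ioo hL.le (ae_of_forall_Icc fun t ht => by rw [h2 ht]; ring)
  filter_upwards [h4, ae_of_forall_Icc h2] with x hx4 hx2
  rw [linOp, hx4, hx2, hi, hi']; ring

/-! ### The nonlinear step on the order interval: monotonicity, contraction, fixed point. -/

/-- The right-hand side of the iteration in terms of `u = -y''`. -/
noncomputable def force (L a b c m N : ℝ) (p u : ℝ → ℝ) (x : ℝ) : ℝ :=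
  p x + (m ^ 2 - (a + b * ∫ t in (0 : ℝ)..L, bump L t * u t)) * u x +
    (N - c) * ∫ t in (0 : ℝ)..L, bump L t * u t

section force

variable {L a b c m N : ℝ} {p y : ℝ → ℝ}

theorem rhs_eq_force (hL : 0 < L) (hy : IsC2Dirichlet L y) (x : ℝ) :
    rhs L a b c p y x - m ^ 2 * D L 2 y x + N * (∫ t in (0 : ℝ)..L, y t) =
      force L a b c m N p (fun x => -D L 2 y x) x := by
  rw [rhs, force, hy.integral_eq hL]; ring

/-- The defect in the linearised equation equals the defect in (P), so solutions, lower and upper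
solutions of (P) become fixed points, sub- and supersolutions of the step. -/
theorem linOp_sub_force (hL : 0 < L) (hy : IsC2Dirichlet L y) (x : ℝ) :
    linOp L (m ^ 2) N y x - force L a b c m N p (fun x => -D L 2 y x) x =
      melanOp L a b c y x - p x := by
  rw [linOp, force, melanOp, hy.integral_eq hL]; ring

theorem force_congr (hL : 0 < L) {u v : ℝ → ℝ} (h : EqOn u v (Icc 0 L)) :
    EqOn (force L a b c m N p u) (force L a b c m N p v) (Icc 0 L) := by
  intro x hx
  have : ∫ t in (0 : ℝ)..L, bump L t * u t = ∫ t in (0 : ℝ)..L, bump L t * v t :=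
    integral_congr_Ioo hL.le (ae_of_forall_Icc fun t ht => by rw [h ht])
  rw [force, force, this, h hx]

theorem intervalIntegrable_force (hL : 0 < L) (hp : IntervalIntegrable p volume 0 L) {u : ℝ → ℝ}
    (hu : ContinuousOn u (Icc 0 L)) : IntervalIntegrable (force L a b c m N p u) volume 0 L := by
  have : IntervalIntegrable (fun x =>
      (m ^ 2 - (a + b * ∫ t in (0 : ℝ)..L, bump L t * u t)) * u x +
      (N - c) * ∫ t in (0 : ℝ)..L, bump L t * u t) volume 0 L :=
    intervalIntegrable_of_continuousOn hL.le (by fun_prop)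
  refine intervalIntegrable_congr_Ioo hL.le (hp.add this) (Eventually.of_forall fun x => ?_)
  simp only [force]; ring

end force

/-- Continuous functions on `[0, L]` between `lo` and `hi`. -/
def InOrder (L : ℝ) (lo hi u : ℝ → ℝ) : Prop :=
  ContinuousOn u (Icc 0 L) ∧ ∀ x ∈ Icc 0 L, lo x ≤ u x ∧ u x ≤ hi x

/-- The standing assumptions on the parameters and on `lo = -α''`, `hi = -β''`. -/
structure IsBarrier (L a b c m N : ℝ) (p lo hi : ℝ → ℝ) : Prop where
  hL : 0 < L
  hb : 0 < b
  hm : 0 < m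
  hN : 0 < N
  hMN : N ≤ 4 * m ^ 2 / L ^ 3 * sigma (m * L)
  integrable : IntervalIntegrable p volume 0 L
  lo_nonneg : ∀ x ∈ Icc 0 L, 0 ≤ lo x
  le : ∀ x ∈ Icc 0 L, lo x ≤ hi x
  boundM : a + b * (∫ t in (0 : ℝ)..L, bump L t * hi t) ≤ m ^ 2
  boundN : ∀ x ∈ Icc 0 L, c + b * hi x ≤ N
  lower : ∃ h, IsLinSol L m N h lo ∧
    ∀ᵐ x ∂volume.restrict (Ioo 0 L), h x ≤ force L a b c m N p lo x
  upper : ∃ h, IsLinSol L m N h hi ∧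
    ∀ᵐ x ∂volume.restrict (Ioo 0 L), force L a b c m N p hi x ≤ h x

/-- The contraction rate in terms of `lo = -α''`. -/
noncomputable def rate (L a b c m N : ℝ) (lo : ℝ → ℝ) : ℝ :=
  L * (Real.tanh (m * L / 2) / (2 * m)) *
    (m ^ 2 - (a + b * ∫ t in (0 : ℝ)..L, bump L t * lo t) + L ^ 3 / 4 * (N - c))

theorem integral_bump_mul_mono {L : ℝ} (hL : 0 < L) {u v : ℝ → ℝ}
    (hu : ContinuousOn u (Icc 0 L)) (hv : ContinuousOn v (Icc 0 L))
    (h : ∀ x ∈ Icc 0 L, u x ≤ v x) :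
    ∫ t in (0 : ℝ)..L, bump L t * u t ≤ ∫ t in (0 : ℝ)..L, bump L t * v t :=
  intervalIntegral.integral_mono_on hL.le
    (intervalIntegrable_of_continuousOn hL.le ((continuous_bump L).continuousOn.mul hu))
    (intervalIntegrable_of_continuousOn hL.le ((continuous_bump L).continuousOn.mul hv))
    fun x hx => mul_le_mul_of_nonneg_left (h x hx) (bump_nonneg hx)

/-- Since `∫ bump = L³ / 12`, the factor `L³ / 12` would do; `L³ / 4` is the one occurring in `ρ`.
-/
theorem abs_integral_bump_mul_sub_le {L δ : ℝ} (hL : 0 < L) {u v : ℝ → ℝ}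
    (hu : ContinuousOn u (Icc 0 L)) (hv : ContinuousOn v (Icc 0 L))
    (h : ∀ x ∈ Icc 0 L, |u x - v x| ≤ δ) :
    |(∫ t in (0 : ℝ)..L, bump L t * u t) - ∫ t in (0 : ℝ)..L, bump L t * v t| ≤
      L ^ 3 / 4 * δ := by
  have hδ0 : 0 ≤ δ := (abs_nonneg _).trans (h 0 ⟨le_rfl, hL.le⟩)
  have e1 := integral_bump_mul_add hL.le δ hu (v := fun _ => 1) continuousOn_const
  have e2 := integral_bump_mul_add hL.le δ hv (v := fun _ => 1) continuousOn_const
  have l1 := integral_bump_mul_mono hL hu (v := fun t => v t + δ * 1) (by fun_prop)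
    fun x hx => by linarith [le_abs_self (u x - v x), h x hx]
  have l2 := integral_bump_mul_mono hL hv (v := fun t => u t + δ * 1) (by fun_prop)
    fun x hx => by linarith [neg_abs_le (u x - v x), h x hx]
  have hb : ∫ t in (0 : ℝ)..L, bump L t * 1 = L ^ 3 / 12 := by
    simpa using integral_bump L
  rw [e2, hb] at l1
  rw [e1, hb] at l2
  have : 0 ≤ δ * L ^ 3 := by positivity
  rw [abs_le]
  constructor <;> linarith

namespace IsBarrier

variable {L a b c m N : ℝ} {p lo hi : ℝ → ℝ}

theorem inOrder_lo (B : IsBarrier L a b c m N p lo hi) : InOrder L lo hi lo := by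
  obtain ⟨h, hs, -⟩ := B.lower
  exact ⟨hs.continuousOn B.hL, fun x hx => ⟨le_rfl, B.le x hx⟩⟩

theorem inOrder_hi (B : IsBarrier L a b c m N p lo hi) : InOrder L lo hi hi := by
  obtain ⟨h, hs, -⟩ := B.upper
  exact ⟨hs.continuousOn B.hL, fun x hx => ⟨B.le x hx, le_rfl⟩⟩

theorem coeff_nonneg (B : IsBarrier L a b c m N p lo hi) {u : ℝ → ℝ} (hu : InOrder L lo hi u) :
    0 ≤ m ^ 2 - (a + b * ∫ t in (0 : ℝ)..L, bump L t * u t) := by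
  have := mul_le_mul_of_nonneg_left
    (integral_bump_mul_mono B.hL hu.1 B.inOrder_hi.1 fun x hx => (hu.2 x hx).2) B.hb.le
  linarith [B.boundM]

theorem le_N (B : IsBarrier L a b c m N p lo hi) : c ≤ N := by
  have h0 : (0 : ℝ) ∈ Icc 0 L := ⟨le_rfl, B.hL.le⟩
  have := mul_nonneg B.hb.le ((B.lo_nonneg 0 h0).trans (B.le 0 h0))
  linarith [B.boundN 0 h0]

theorem rate_nonneg (B : IsBarrier L a b c m N p lo hi) : 0 ≤ rate L a b c m N lo := by
  have h1 := B.coeff_nonneg B.inOrder_lo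
  have h2 := B.le_N
  have := B.hL
  have := B.hm
  have h3 : 0 ≤ Real.tanh (m * L / 2) := by
    rw [Real.tanh_eq_sinh_div_cosh]
    exact div_nonneg (Real.sinh_nonneg_iff.2 (by positivity)) (Real.cosh_pos _).le
  have h4 : 0 ≤ L ^ 3 / 4 * (N - c) := mul_nonneg (by positivity) (by linarith)
  rw [rate]
  exact mul_nonneg (by positivity) (by linarith)

/-- By `tanh z ≤ z` the prefactor is at most `L² / 4`, and `hlt` says that the bracket is below `4 /
L²`. -/
theorem rate_lt_one (B : IsBarrier L a b c m N p lo hi)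
    (hlt : L ^ 3 * N / 4 + m ^ 2 - 4 / L ^ 2 <
      a + b * (∫ t in (0 : ℝ)..L, bump L t * lo t) + L ^ 3 / 4 * c) :
    rate L a b c m N lo < 1 := by
  have h1 := B.coeff_nonneg B.inOrder_lo
  have h2 := B.le_N
  have hL := B.hL
  have hm := B.hm
  have h3 := tanh_le_self (z := m * L / 2) (by positivity)
  have h4 : 0 ≤ L ^ 3 / 4 * (N - c) := mul_nonneg (by positivity) (by linarith)
  have h5 : L * (Real.tanh (m * L / 2) / (2 * m)) ≤ L ^ 2 / 4 := by
    calc L * (Real.tanh (m * L / 2) / (2 * m)) ≤ L * ((m * L / 2) / (2 * m)) := by gcongr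
      _ = L ^ 2 / 4 := by field_simp; ring
  rw [rate]
  calc _ ≤ L ^ 2 / 4 * (m ^ 2 - (a + b * ∫ t in (0 : ℝ)..L, bump L t * lo t) +
        L ^ 3 / 4 * (N - c)) := mul_le_mul_of_nonneg_right h5 (by linarith)
    _ < L ^ 2 / 4 * (4 / L ^ 2) := mul_lt_mul_of_pos_left (by linarith) (by positivity)
    _ = 1 := by field_simp

/-- `F(v) - F(u) = (m² - a - b K(v)) (v - u) + (N - c - b u) (K(v) - K(u))`; `boundM` and `boundN`
make both coefficients nonnegative. -/
theorem force_mono (B : IsBarrier L a b c m N p lo hi) {u v : ℝ → ℝ} (hu : InOrder L lo hi u)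
    (hv : InOrder L lo hi v) (h : ∀ x ∈ Icc 0 L, u x ≤ v x) :
    ∀ x ∈ Icc 0 L, force L a b c m N p u x ≤ force L a b c m N p v x := by
  intro x hx
  have h1 := mul_nonneg (B.coeff_nonneg hv) (sub_nonneg.2 (h x hx))
  have h2 : 0 ≤ N - c - b * u x := by
    have := mul_le_mul_of_nonneg_left (hu.2 x hx).2 B.hb.le
    linarith [B.boundN x hx]
  have h3 := mul_nonneg h2 (sub_nonneg.2 (integral_bump_mul_mono B.hL hu.1 hv.1 h))
  rw [force, force]
  linarith

/-- In the same splitting the coefficients are at most `m² - a - b K(lo)` and `N - c`, because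
`K(lo) ≤ K(u)` and `v ≥ 0`. -/
theorem abs_force_sub_le (B : IsBarrier L a b c m N p lo hi) {u v : ℝ → ℝ}
    (hu : InOrder L lo hi u) (hv : InOrder L lo hi v) {δ : ℝ}
    (h : ∀ x ∈ Icc 0 L, |u x - v x| ≤ δ) :
    ∀ x ∈ Icc 0 L, |force L a b c m N p u x - force L a b c m N p v x| ≤
      (m ^ 2 - (a + b * ∫ t in (0 : ℝ)..L, bump L t * lo t) + L ^ 3 / 4 * (N - c)) * δ := by
  intro x hx
  have hδ0 : 0 ≤ δ := (abs_nonneg _).trans (h x hx)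
  have h1 := B.coeff_nonneg hu
  have h1' := mul_le_mul_of_nonneg_left
    (integral_bump_mul_mono B.hL B.inOrder_lo.1 hu.1 fun x hx => (hu.2 x hx).1) B.hb.le
  have h2 : 0 ≤ N - c - b * v x := by
    have := mul_le_mul_of_nonneg_left (hv.2 x hx).2 B.hb.le
    linarith [B.boundN x hx]
  have h2' : 0 ≤ b * v x := mul_nonneg B.hb.le ((B.lo_nonneg x hx).trans (hv.2 x hx).1)
  have h3 := abs_integral_bump_mul_sub_le B.hL hu.1 hv.1 h
  have hLδ : 0 ≤ L ^ 3 / 4 * δ := by have := B.hL; positivity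
  set Ku := ∫ t in (0 : ℝ)..L, bump L t * u t with hKu
  set Kv := ∫ t in (0 : ℝ)..L, bump L t * v t with hKv
  have e : force L a b c m N p u x - force L a b c m N p v x =
      (m ^ 2 - (a + b * Ku)) * (u x - v x) + (N - c - b * v x) * (Ku - Kv) := by
    rw [force, force, ← hKu, ← hKv]; ring
  rw [e]
  calc _ ≤ |(m ^ 2 - (a + b * Ku)) * (u x - v x)| + |(N - c - b * v x) * (Ku - Kv)| :=
        abs_add_le _ _
    _ = (m ^ 2 - (a + b * Ku)) * |u x - v x| + (N - c - b * v x) * |Ku - Kv| := by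
        rw [abs_mul, abs_mul, abs_of_nonneg h1, abs_of_nonneg h2]
    _ ≤ (m ^ 2 - (a + b * ∫ t in (0 : ℝ)..L, bump L t * lo t)) * δ +
        (N - c) * (L ^ 3 / 4 * δ) := by
        refine add_le_add (mul_le_mul (by linarith) (h x hx) (abs_nonneg _) (by linarith))
          (mul_le_mul (by linarith) h3 (abs_nonneg _) (by linarith [B.le_N]))
    _ = _ := by ring

variable {u v u₁ v₁ : ℝ → ℝ}

theorem step_mono (B : IsBarrier L a b c m N p lo hi) (hu : InOrder L lo hi u)
    (hv : InOrder L lo hi v) (hu₁ : IsLinSol L m N (force L a b c m N p u) u₁)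
    (hv₁ : IsLinSol L m N (force L a b c m N p v) v₁) (h : ∀ x ∈ Icc 0 L, u x ≤ v x) :
    ∀ x ∈ Icc 0 L, u₁ x ≤ v₁ x :=
  hu₁.mono B.hL B.hm B.hN B.hMN hv₁ (ae_of_forall_Icc (B.force_mono hu hv h))

theorem step_contract (B : IsBarrier L a b c m N p lo hi) (hu : InOrder L lo hi u)
    (hv : InOrder L lo hi v) (hu₁ : IsLinSol L m N (force L a b c m N p u) u₁)
    (hv₁ : IsLinSol L m N (force L a b c m N p v) v₁) {δ : ℝ}
    (h : ∀ x ∈ Icc 0 L, |u x - v x| ≤ δ) :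
    ∀ x ∈ Icc 0 L, |u₁ x - v₁ x| ≤ rate L a b c m N lo * δ := by
  have hf := B.abs_force_sub_le hu hv h
  have hpos := (abs_nonneg _).trans (hf 0 ⟨le_rfl, B.hL.le⟩)
  intro x hx
  refine ((hu₁.sub B.hL hv₁).abs_le B.hL B.hm B.hN B.hMN hpos (ae_of_forall_Icc hf) x
    hx).trans_eq ?_
  rw [rate]; ring

/-- Monotonicity of `F` and the sub- and supersolution inequalities place the right-hand side for
`u₁` between those of `lo` and `hi`; comparison does the rest. -/
theorem step_mem (B : IsBarrier L a b c m N p lo hi) (hu : InOrder L lo hi u)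
    (hu₁ : IsLinSol L m N (force L a b c m N p u) u₁) : InOrder L lo hi u₁ := by
  obtain ⟨h, hs, hle⟩ := B.lower
  obtain ⟨g, gs, gle⟩ := B.upper
  refine ⟨hu₁.continuousOn B.hL, fun x hx => ⟨?_, ?_⟩⟩
  · refine hs.mono B.hL B.hm B.hN B.hMN hu₁ ?_ x hx
    filter_upwards [hle, ae_of_forall_Icc (B.force_mono B.inOrder_lo hu fun x hx => (hu.2 x hx).1)]
      with t h1 h2 using h1.trans h2
  · refine hu₁.mono B.hL B.hm B.hN B.hMN gs ?_ x hx
    filter_upwards [gle, ae_of_forall_Icc (B.force_mono hu B.inOrder_hi fun x hx => (hu.2 x hx).2)]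
      with t h1 h2 using h2.trans h1

theorem exists_fixedPoint (B : IsBarrier L a b c m N p lo hi) (hρ : rate L a b c m N lo < 1) :
    ∃ u, InOrder L lo hi u ∧ IsLinSol L m N (force L a b c m N p u) u := by
  have hL := B.hL.le
  let E : C(Icc (0 : ℝ) L, ℝ) → ℝ → ℝ := fun u => IccExtend hL u
  have hE : ∀ u, Continuous (E u) := fun u => u.continuous.Icc_extend'
  have hEx : ∀ u (x : Icc (0 : ℝ) L), E u x = u x := fun u x => IccExtend_val hL u x
  -- The step is defined on all of `C([0, L])`; invariance and contraction are claimed only on the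
  -- closed set `s`.
  choose sol hsol using fun u => exists_isLinSol B.hL B.hm B.hN
    (intervalIntegrable_force (a := a) (b := b) (c := c) (m := m) (N := N) B.hL B.integrable
      (hE u).continuousOn)
  let Φ : C(Icc (0 : ℝ) L, ℝ) → C(Icc (0 : ℝ) L, ℝ) := fun u =>
    ⟨(Icc 0 L).domRestrict (sol u), ((hsol u).continuousOn B.hL).domRestrict⟩
  let s : Set C(Icc (0 : ℝ) L, ℝ) := {u | ∀ x : Icc (0 : ℝ) L, lo x ≤ u x ∧ u x ≤ hi x}
  have hs : ∀ u ∈ s, InOrder L lo hi (E u) := fun u hu =>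
    ⟨(hE u).continuousOn, fun x hx => by rw [hEx u ⟨x, hx⟩]; exact hu ⟨x, hx⟩⟩
  have hclosed : IsClosed s := by
    have : s = ⋂ x : Icc (0 : ℝ) L, {u | lo x ≤ u x ∧ u x ≤ hi x} := by ext; simp [s]
    rw [this]
    refine isClosed_iInter fun x => ?_
    have hc : Continuous fun u : C(Icc (0 : ℝ) L, ℝ) => u x :=
      continuous_eval_const x
    exact (isClosed_le continuous_const hc).inter (isClosed_le hc continuous_const)
  have hmaps : MapsTo Φ s s := fun u hu x => (B.step_mem (hs u hu) (hsol u)).2 x x.2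
  have hcontr : ContractingWith ⟨rate L a b c m N lo, B.rate_nonneg⟩ (hmaps.restrict Φ s s) := by
    refine ⟨by exact_mod_cast hρ, LipschitzWith.of_dist_le_mul fun u v => ?_⟩
    change dist (Φ u) (Φ v) ≤ rate L a b c m N lo * dist u.1 v.1
    rw [ContinuousMap.dist_le (mul_nonneg B.rate_nonneg dist_nonneg)]
    intro x
    refine B.step_contract (hs u u.2) (hs v v.2) (hsol u) (hsol v) (fun t ht => ?_) x x.2
    rw [hEx _ ⟨t, ht⟩, hEx _ ⟨t, ht⟩]
    exact ContinuousMap.dist_apply_le_dist (f := u.1) (g := v.1) ⟨t, ht⟩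
  let x₀ : C(Icc (0 : ℝ) L, ℝ) := ⟨(Icc 0 L).domRestrict lo, B.inOrder_lo.1.domRestrict⟩
  obtain ⟨u, hu, hfix, -⟩ := hcontr.exists_fixedPoint' hclosed.isComplete hmaps
    (x := x₀) (fun x => ⟨le_rfl, B.le x x.2⟩) (edist_ne_top _ _)
  refine ⟨E u, hs u hu, (hsol u).congr B.hL (fun x hx => ?_) (Eventually.of_forall fun _ => rfl)⟩
  rw [hEx u ⟨x, hx⟩]
  exact congrArg (fun w : C(Icc (0 : ℝ) L, ℝ) => w ⟨x, hx⟩) hfix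

end IsBarrier

/-! ### Sup norm and iterative sequences. -/

theorem supNorm_le {L C : ℝ} (hL : 0 < L) {g : ℝ → ℝ} (h : ∀ x ∈ Icc 0 L, |g x| ≤ C) :
    supNorm L g ≤ C := by
  refine csSup_le ⟨_, 0, ⟨le_rfl, hL.le⟩, rfl⟩ ?_
  rintro _ ⟨x, hx, rfl⟩
  exact h x hx

theorem abs_le_supNorm {L : ℝ} {g : ℝ → ℝ} (hg : ContinuousOn g (Icc 0 L)) {x : ℝ}
    (hx : x ∈ Icc 0 L) : |g x| ≤ supNorm L g :=
  le_csSup (isCompact_Icc.bddAbove_image hg.abs) ⟨x, hx, rfl⟩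

theorem exists_isIteration {L a b c m N : ℝ} {p : ℝ → ℝ} (hL : 0 < L) (hm : 0 < m) (hN : 0 < N)
    (hp : IntervalIntegrable p volume 0 L) {y₀ : ℝ → ℝ} (hy₀ : IsC2Dirichlet L y₀) :
    ∃ Y, IsIteration L a b c (m ^ 2) N p y₀ Y := by
  -- Recursion runs in `C²` Dirichlet functions, the regularity used to rewrite the right-hand side
  -- as `force`.
  have step : ∀ y : {y // IsC2Dirichlet L y}, ∃ z : {y // IsC2Dirichlet L y},
      MemW41 L z.1 ∧ (∀ᵐ x ∂volume.restrict (Ioo 0 L), linOp L (m ^ 2) N z.1 x =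
        rhs L a b c p y.1 x - m ^ 2 * D L 2 y.1 x + N * ∫ t in (0 : ℝ)..L, y.1 t) ∧
      NavierBC L z.1 := by
    intro ⟨y, hy⟩
    obtain ⟨u, hu⟩ := exists_isLinSol hL hm hN (intervalIntegrable_force (a := a) (b := b) (c := c)
      (m := m) (N := N) hL hp (hy.continuousOn_D2 hL).neg)
    obtain ⟨z, hW, hbc, -, hz⟩ := exists_of_isLinSol hL hu
    refine ⟨⟨z, .of_memW41 hW hbc⟩, hW, ?_, hbc⟩
    filter_upwards [hz] with x hx
    rw [hx, rhs_eq_force hL hy]; rfl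
  choose next hnext using step
  refine ⟨fun n => (n.rec ⟨y₀, hy₀⟩ fun _ y => next y : {y // IsC2Dirichlet L y}).1, rfl,
    fun n => hnext _⟩

/-- The functions `u = -y''` of an iteration solve the linear problems. -/
theorem IsIteration.isLinSol {L a b c m N : ℝ} {p y₀ : ℝ → ℝ} {Y : ℕ → ℝ → ℝ} (hL : 0 < L)
    (hy₀ : IsC2Dirichlet L y₀) (hY : IsIteration L a b c (m ^ 2) N p y₀ Y) :
    (∀ n, IsC2Dirichlet L (Y n)) ∧
      ∀ n, IsLinSol L m N (force L a b c m N p fun x => -D L 2 (Y n) x)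
        (fun x => -D L 2 (Y (n + 1)) x) := by
  have hC : ∀ n, IsC2Dirichlet L (Y n) := by
    intro n
    cases n with
    | zero => rw [hY.1]; exact hy₀
    | succ n => exact .of_memW41 (hY.2 n).1 (hY.2 n).2.2
  refine ⟨hC, fun n => isLinSol_of_linOp hL (hY.2 n).1 (hY.2 n).2.2 ?_⟩
  filter_upwards [(hY.2 n).2.1] with x hx
  rw [hx, rhs_eq_force hL (hC n)]

namespace IsBarrier

variable {L a b c m N : ℝ} {p lo hi : ℝ → ℝ} {U V : ℕ → ℝ → ℝ}

theorem seq_mem (B : IsBarrier L a b c m N p lo hi) (h0 : InOrder L lo hi (U 0))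
    (hU : ∀ n, IsLinSol L m N (force L a b c m N p (U n)) (U (n + 1))) (n : ℕ) :
    InOrder L lo hi (U n) := by
  induction n with
  | zero => exact h0
  | succ n ih => exact B.step_mem ih (hU n)

theorem seq_le (B : IsBarrier L a b c m N p lo hi) (hU0 : InOrder L lo hi (U 0))
    (hV0 : InOrder L lo hi (V 0))
    (hU : ∀ n, IsLinSol L m N (force L a b c m N p (U n)) (U (n + 1)))
    (hV : ∀ n, IsLinSol L m N (force L a b c m N p (V n)) (V (n + 1)))
    (h : ∀ x ∈ Icc 0 L, U 0 x ≤ V 0 x) (n : ℕ) : ∀ x ∈ Icc 0 L, U n x ≤ V n x := by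
  induction n with
  | zero => exact h
  | succ n ih =>
    exact B.step_mono (B.seq_mem hU0 hU n) (B.seq_mem hV0 hV n) (hU n) (hV n) ih

theorem seq_contract (B : IsBarrier L a b c m N p lo hi) (hU0 : InOrder L lo hi (U 0))
    (hV0 : InOrder L lo hi (V 0))
    (hU : ∀ n, IsLinSol L m N (force L a b c m N p (U n)) (U (n + 1)))
    (hV : ∀ n, IsLinSol L m N (force L a b c m N p (V n)) (V (n + 1))) {δ : ℝ}
    (h : ∀ x ∈ Icc 0 L, |U 0 x - V 0 x| ≤ δ) (n : ℕ) :
    ∀ x ∈ Icc 0 L, |U n x - V n x| ≤ rate L a b c m N lo ^ n * δ := by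
  induction n with
  | zero => simpa using h
  | succ n ih =>
    intro x hx
    refine (B.step_contract (B.seq_mem hU0 hU n) (B.seq_mem hV0 hV n) (hU n) (hV n) ih x
      hx).trans_eq ?_
    ring

end IsBarrier

theorem InOrder.abs_sub_le {L : ℝ} {lo hi u v : ℝ → ℝ} (hu : InOrder L lo hi u)
    (hv : InOrder L lo hi v) {x : ℝ} (hx : x ∈ Icc 0 L) : |u x - v x| ≤ hi x - lo x := by
  have h1 := hu.2 x hx
  have h2 := hv.2 x hx
  rw [abs_le]
  constructor <;> linarith

/-! ### Translation of the hypotheses, solutions and error estimates. -/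

theorem isBarrier_of_lower_upper {L a b c m N : ℝ} {p α β : ℝ → ℝ} (hL : 0 < L) (hb : 0 < b)
    (hm : 0 < m) (hN : 0 < N) (hp : IntegrableOn p (Icc 0 L) volume)
    (hMN : N ≤ 4 * m ^ 2 / L ^ 3 * sigma (m * L))
    (hα : IsLowerSolution L a b c p α) (hβ : IsUpperSolution L a b c p β)
    (hord2 : ∀ x ∈ Icc (0 : ℝ) L, D L 2 α x ≤ 0 ∧ D L 2 β x ≤ D L 2 α x)
    (hboundM : a + b * ∫ t in (0 : ℝ)..L, β t ≤ m ^ 2)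
    (hboundN : c - b * sInf (D L 2 β '' Icc 0 L) ≤ N) :
    IsBarrier L a b c m N p (fun x => -D L 2 α x) (fun x => -D L 2 β x) := by
  have cα := IsC2Dirichlet.of_memW41 hα.1 hα.2.2
  have cβ := IsC2Dirichlet.of_memW41 hβ.1 hβ.2.2
  refine ⟨hL, hb, hm, hN, hMN, ?_, fun x hx => by linarith [(hord2 x hx).1],
    fun x hx => by linarith [(hord2 x hx).2], ?_, fun x hx => ?_, ?_, ?_⟩
  · rw [intervalIntegrable_iff_integrableOn_Icc_of_le hL.le]; exact hp
  · rwa [cβ.integral_eq hL] at hboundM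
  · have : sInf (D L 2 β '' Icc 0 L) ≤ D L 2 β x :=
      csInf_le (isCompact_Icc.bddBelow_image (cβ.continuousOn_D2 hL)) ⟨x, hx, rfl⟩
    have := mul_le_mul_of_nonneg_left this hb.le
    linarith
  · refine ⟨linOp L (m ^ 2) N α, isLinSol_of_linOp hL hα.1 hα.2.2
      (Eventually.of_forall fun _ => rfl), ?_⟩
    filter_upwards [hα.2.1] with x hx
    have := linOp_sub_force (a := a) (b := b) (c := c) (m := m) (N := N) (p := p) hL cα x
    linarith
  · refine ⟨linOp L (m ^ 2) N β, isLinSol_of_linOp hL hβ.1 hβ.2.2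
      (Eventually.of_forall fun _ => rfl), ?_⟩
    filter_upwards [hβ.2.1] with x hx
    have := linOp_sub_force (a := a) (b := b) (c := c) (m := m) (N := N) (p := p) hL cβ x
    linarith

/-- The maximum of `α''` is `0`, attained at the end point by the boundary condition, so the term `b
max α''` drops out. -/
theorem rho_eq_rate {L a b c m N : ℝ} {α : ℝ → ℝ} (hL : 0 < L) (hm : 0 < m)
    (cα : IsC2Dirichlet L α) (h0 : D L 2 α 0 = 0) (hneg : ∀ x ∈ Icc 0 L, D L 2 α x ≤ 0) :
    rho L a b c (m ^ 2) N α = rate L a b c m N (fun x => -D L 2 α x) := by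
  have hs : sSup (D L 2 α '' Icc 0 L) = 0 := by
    refine IsGreatest.csSup_eq ⟨⟨0, ⟨le_rfl, hL.le⟩, h0⟩, ?_⟩
    rintro _ ⟨x, hx, rfl⟩
    exact hneg x hx
  rw [rho, rate, hs, Real.sqrt_sq hm.le, cα.integral_eq hL]
  ring

theorem isLinSol_of_isSolution {L a b c m N : ℝ} {p y : ℝ → ℝ} (hL : 0 < L)
    (hy : IsSolution L a b c p y) :
    IsLinSol L m N (force L a b c m N p fun x => -D L 2 y x) (fun x => -D L 2 y x) := by
  refine isLinSol_of_linOp hL hy.1 hy.2.2 ?_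
  filter_upwards [hy.2.1] with x hx
  have := linOp_sub_force (a := a) (b := b) (c := c) (m := m) (N := N) (p := p) hL
    (.of_memW41 hy.1 hy.2.2) x
  linarith

theorem exists_isSolution {L a b c m N : ℝ} {p u : ℝ → ℝ} (hL : 0 < L)
    (hu : IsLinSol L m N (force L a b c m N p u) u) :
    ∃ y, IsSolution L a b c p y ∧ EqOn (fun x => -D L 2 y x) u (Icc 0 L) := by
  obtain ⟨y, hW, hbc, h2, heq⟩ := exists_of_isLinSol hL hu
  have h2' : EqOn (fun x => -D L 2 y x) u (Icc 0 L) := fun x hx => by simp [h2 hx]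
  refine ⟨y, ⟨hW, ?_, hbc⟩, h2'⟩
  filter_upwards [heq, ae_of_forall_Icc (force_congr (a := a) (b := b) (c := c) (m := m) (N := N)
    (p := p) hL h2')] with x hx hx'
  have := linOp_sub_force (a := a) (b := b) (c := c) (m := m) (N := N) (p := p) hL
    (.of_memW41 hW hbc) x
  linarith

/-- Error estimates for an iteration, with `M = m²`. -/
theorem IsIteration.estimates {L a b c m N : ℝ} {p lo hi y y₀ : ℝ → ℝ} {Y : ℕ → ℝ → ℝ}
    (B : IsBarrier L a b c m N p lo hi) (hρ : rate L a b c m N lo < 1)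
    (hy : IsSolution L a b c p y) (hym : InOrder L lo hi (fun x => -D L 2 y x))
    (hy₀ : IsC2Dirichlet L y₀) (h0 : InOrder L lo hi (fun x => -D L 2 y₀ x))
    (hY : IsIteration L a b c (m ^ 2) N p y₀ Y) {S : ℝ} (hS : ∀ x ∈ Icc 0 L, hi x - lo x ≤ S)
    (n : ℕ) :
    (supNorm L (fun x => Y (n + 1) x - Y n x) ≤
        L ^ 2 / 4 * supNorm L (fun x => D L 2 (Y (n + 1)) x - D L 2 (Y n) x) ∧
      L ^ 2 / 4 * supNorm L (fun x => D L 2 (Y (n + 1)) x - D L 2 (Y n) x) ≤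
        L ^ 2 / 4 * rate L a b c m N lo ^ n *
          supNorm L (fun x => D L 2 (Y 1) x - D L 2 (Y 0) x) ∧
      L ^ 2 / 4 * rate L a b c m N lo ^ n *
          supNorm L (fun x => D L 2 (Y 1) x - D L 2 (Y 0) x) ≤
        L ^ 2 / 4 * rate L a b c m N lo ^ n * S) ∧
    (supNorm L (fun x => Y n x - y x) ≤
        L ^ 2 / 4 * supNorm L (fun x => D L 2 (Y n) x - D L 2 y x) ∧
      L ^ 2 / 4 * supNorm L (fun x => D L 2 (Y n) x - D L 2 y x) ≤
        L ^ 2 / 4 * (rate L a b c m N lo ^ n / (1 - rate L a b c m N lo)) * S) := by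
  have hL := B.hL
  have hr := B.rate_nonneg
  obtain ⟨hC, hsol⟩ := hY.isLinSol hL hy₀
  have cy := IsC2Dirichlet.of_memW41 hy.1 hy.2.2
  have hsoly := isLinSol_of_isSolution (m := m) (N := N) hL hy
  let U : ℕ → ℝ → ℝ := fun n x => -D L 2 (Y n) x
  have hU0 : InOrder L lo hi (U 0) := by simp only [U, hY.1]; exact h0
  have hU1 := B.step_mem hU0 (hsol 0)
  have cont : ∀ {u v}, IsC2Dirichlet L u → IsC2Dirichlet L v →
      ContinuousOn (fun x => D L 2 u x - D L 2 v x) (Icc 0 L) := fun hu hv =>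
    (hu.continuousOn_D2 hL).sub (hv.continuousOn_D2 hL)
  have flip : ∀ s t : ℝ, |-s - -t| = |s - t| := fun s t => by
    rw [← abs_neg]; congr 1; ring
  have hS0 : 0 ≤ S := (abs_nonneg _).trans
    ((hU0.abs_sub_le hym ⟨le_rfl, hL.le⟩).trans (hS 0 ⟨le_rfl, hL.le⟩))
  have hρn : 0 ≤ rate L a b c m N lo ^ n := pow_nonneg hr n
  refine ⟨⟨?_, ?_, ?_⟩, ?_, ?_⟩
  · exact supNorm_le hL ((hC (n + 1)).abs_sub_le hL (hC n)
      fun x hx => abs_le_supNorm (cont (hC (n + 1)) (hC n)) hx)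
  · rw [mul_assoc]
    refine mul_le_mul_of_nonneg_left (supNorm_le hL fun x hx => ?_) (by positivity)
    -- Consecutive differences are distances between the sequence and its own shift, itself an
    -- iteration.
    have := B.seq_contract (U := fun n => U (n + 1)) (V := U) hU1 hU0 (fun n => hsol (n + 1)) hsol
      (δ := supNorm L (fun x => D L 2 (Y 1) x - D L 2 (Y 0) x))
      (fun x hx => by
        simp only [U, flip]
        exact abs_le_supNorm (cont (hC 1) (hC 0)) hx) n x hx
    simpa only [U, flip] using this
  · refine mul_le_mul_of_nonneg_left (supNorm_le hL fun x hx => ?_) (by positivity)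
    have := (hU1.abs_sub_le hU0 hx).trans (hS x hx)
    simpa only [U, flip] using this
  · exact supNorm_le hL ((hC n).abs_sub_le hL cy
      fun x hx => abs_le_supNorm (cont (hC n) cy) hx)
  · rw [mul_assoc]
    refine mul_le_mul_of_nonneg_left (supNorm_le hL fun x hx => ?_) (by positivity)
    have := B.seq_contract (U := U) (V := fun _ x => -D L 2 y x) hU0 hym hsol (fun _ => hsoly)
      (fun x hx => (hU0.abs_sub_le hym hx).trans (hS x hx)) n x hx
    simp only [U, flip] at this
    -- The solution is a constant iteration in the same interval, which gives the sharper `ρⁿ S`; it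
    -- remains to use `ρⁿ ≤ ρⁿ / (1 - ρ)`.
    refine this.trans (mul_le_mul_of_nonneg_right ?_ hS0)
    rw [le_div_iff₀ (by linarith)]
    exact mul_le_of_le_one_right hρn (by linarith)

theorem tendstoUniformlyOn_of_supNorm_le {L : ℝ} {Y : ℕ → ℝ → ℝ} {y : ℝ → ℝ} {e : ℕ → ℝ}
    (hc : ∀ n, ContinuousOn (fun x => Y n x - y x) (Icc 0 L))
    (hle : ∀ n, supNorm L (fun x => Y n x - y x) ≤ e n) (he : Tendsto e atTop (𝓝 0)) :
    TendstoUniformlyOn Y y atTop (Icc 0 L) := by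
  rw [Metric.tendstoUniformlyOn_iff]
  intro ε hε
  filter_upwards [he.eventually_lt_const hε] with n hn x hx
  rw [dist_comm, Real.dist_eq]
  exact (abs_le_supNorm (hc n) hx).trans_lt ((hle n).trans_lt hn)

end Melan

/-! ### The main theorem. -/

open Melan in
theorem corollary4p1
    (L a b c M N : ℝ) (hL : 0 < L) (ha : 0 < a) (hb : 0 < b) (hc : 0 < c)
    (hM : 0 < M) (hN : 0 < N)
    (p : ℝ → ℝ) (hp : IntegrableOn p (Icc 0 L) volume)
    (hMN : N ≤ 4 * M / L ^ 3 * sigma (√M * L))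
    (α β : ℝ → ℝ)
    (hα : IsLowerSolution L a b c p α) (hβ : IsUpperSolution L a b c p β)
    (hord : ∀ x ∈ Icc (0 : ℝ) L, 0 ≤ α x ∧ α x ≤ β x)
    (hord2 : ∀ x ∈ Icc (0 : ℝ) L, D L 2 α x ≤ 0 ∧ D L 2 β x ≤ D L 2 α x)
    (hboundM : a + b * ∫ t in (0 : ℝ)..L, β t ≤ M)
    (hboundN : c - b * sInf (D L 2 β '' Icc 0 L) ≤ N)
    (huniq : L ^ 3 * N / 4 + M - 4 / L ^ 2 <
      a + b * (∫ t in (0 : ℝ)..L, α t) + L ^ 3 / 4 * c) :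
    0 ≤ rho L a b c M N α ∧ rho L a b c M N α < 1 ∧
    -- the iterative sequences started at `α` and at `β` exist
    (∃ A, IsIteration L a b c M N p α A) ∧ (∃ B, IsIteration L a b c M N p β B) ∧
    ∃ y : ℝ → ℝ,
      -- `y` is the unique solution in the sector
      (IsSolution L a b c p y ∧ y ∈ sector L α β ∧
        ∀ z, IsSolution L a b c p z → z ∈ sector L α β → EqOn z y (Icc 0 L)) ∧
      ∀ A B : ℕ → ℝ → ℝ,
        IsIteration L a b c M N p α A → IsIteration L a b c M N p β B →
        -- monotonicity
        (∀ n, Below L (A n) (A (n + 1)) ∧ Below L (A n) (B n) ∧ Below L (B (n + 1)) (B n)) ∧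
        -- uniform convergence
        TendstoUniformlyOn A y atTop (Icc 0 L) ∧ TendstoUniformlyOn B y atTop (Icc 0 L) ∧
        -- estimates for both sequences
        (∀ Y, Y = A ∨ Y = B → ∀ n : ℕ,
          (supNorm L (fun x => Y (n + 1) x - Y n x) ≤
              L ^ 2 / 4 * supNorm L (fun x => D L 2 (Y (n + 1)) x - D L 2 (Y n) x) ∧
            L ^ 2 / 4 * supNorm L (fun x => D L 2 (Y (n + 1)) x - D L 2 (Y n) x) ≤
              L ^ 2 / 4 * rho L a b c M N α ^ n *
                supNorm L (fun x => D L 2 (Y 1) x - D L 2 (Y 0) x) ∧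
            L ^ 2 / 4 * rho L a b c M N α ^ n *
                supNorm L (fun x => D L 2 (Y 1) x - D L 2 (Y 0) x) ≤
              L ^ 2 / 4 * rho L a b c M N α ^ n *
                supNorm L (fun x => D L 2 α x - D L 2 β x)) ∧
          (supNorm L (fun x => Y n x - y x) ≤
              L ^ 2 / 4 * supNorm L (fun x => D L 2 (Y n) x - D L 2 y x) ∧
            L ^ 2 / 4 * supNorm L (fun x => D L 2 (Y n) x - D L 2 y x) ≤
              L ^ 2 / 4 * (rho L a b c M N α ^ n / (1 - rho L a b c M N α)) *
                supNorm L (fun x => D L 2 α x - D L 2 β x))) ∧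
        -- the bounds tend to zero
        Tendsto (fun n : ℕ => L ^ 2 / 4 * rho L a b c M N α ^ n *
            supNorm L (fun x => D L 2 α x - D L 2 β x)) atTop (𝓝 0) ∧
        Tendsto (fun n : ℕ => L ^ 2 / 4 *
            (rho L a b c M N α ^ n / (1 - rho L a b c M N α)) *
            supNorm L (fun x => D L 2 α x - D L 2 β x)) atTop (𝓝 0) := by
  obtain ⟨m, hm, rfl⟩ : ∃ m, 0 < m ∧ M = m ^ 2 :=
    ⟨√M, Real.sqrt_pos.2 hM, (Real.sq_sqrt hM.le).symm⟩
  rw [Real.sqrt_sq hm.le] at hMN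
  have cα := IsC2Dirichlet.of_memW41 hα.1 hα.2.2
  have cβ := IsC2Dirichlet.of_memW41 hβ.1 hβ.2.2
  have B := isBarrier_of_lower_upper hL hb hm hN hp hMN hα hβ hord2 hboundM hboundN
  rw [cα.integral_eq hL] at huniq
  have hρ0 := B.rate_nonneg
  have hρ1 := B.rate_lt_one huniq
  rw [rho_eq_rate hL hm cα hα.2.2.2.2.1 fun x hx => (hord2 x hx).1]
  refine ⟨hρ0, hρ1, exists_isIteration hL hm hN B.integrable cα,
    exists_isIteration hL hm hN B.integrable cβ, ?_⟩
  obtain ⟨u, hu, husol⟩ := B.exists_fixedPoint hρ1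
  obtain ⟨y, hy, hyu⟩ := exists_isSolution hL husol
  have cy := IsC2Dirichlet.of_memW41 hy.1 hy.2.2
  have hym : InOrder L (fun x => -D L 2 α x) (fun x => -D L 2 β x) (fun x => -D L 2 y x) :=
    ⟨(cy.continuousOn_D2 hL).neg, fun x hx => by
      have h1 := hu.2 x hx
      rwa [← hyu hx] at h1⟩
  have hpow : Tendsto (fun n : ℕ => rate L a b c m N (fun x => -D L 2 α x) ^ n) atTop (𝓝 0) :=
    tendsto_pow_atTop_nhds_zero_of_lt_one hρ0 hρ1
  have hS : ∀ x ∈ Icc 0 L, -D L 2 β x - -D L 2 α x ≤ supNorm L (fun x => D L 2 α x - D L 2 β x) :=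
    fun x hx => by
      have h1 := abs_le_supNorm (g := fun x => D L 2 α x - D L 2 β x)
        ((cα.continuousOn_D2 hL).sub (cβ.continuousOn_D2 hL)) hx
      have h2 := le_abs_self (D L 2 α x - D L 2 β x)
      linarith
  have lim1 : Tendsto (fun n : ℕ => L ^ 2 / 4 * rate L a b c m N (fun x => -D L 2 α x) ^ n *
      supNorm L (fun x => D L 2 α x - D L 2 β x)) atTop (𝓝 0) := by
    simpa using (hpow.const_mul (L ^ 2 / 4)).mul_const _
  have lim2 : Tendsto (fun n : ℕ => L ^ 2 / 4 * (rate L a b c m N (fun x => -D L 2 α x) ^ n /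
      (1 - rate L a b c m N (fun x => -D L 2 α x))) *
      supNorm L (fun x => D L 2 α x - D L 2 β x)) atTop (𝓝 0) := by
    simpa using ((hpow.div_const _).const_mul (L ^ 2 / 4)).mul_const _
  refine ⟨y, ⟨hy, ⟨cy.1, cα.below hL cy fun x hx => (hym.2 x hx).1,
    cy.below hL cβ fun x hx => (hym.2 x hx).2⟩, ?_⟩, ?_⟩
  · intro z hz hzmem x hx
    have cz := IsC2Dirichlet.of_memW41 hz.1 hz.2.2
    have hzm : InOrder L (fun x => -D L 2 α x) (fun x => -D L 2 β x) (fun x => -D L 2 z x) :=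
      ⟨(cz.continuousOn_D2 hL).neg, fun x hx =>
        ⟨neg_le_neg (hzmem.2.1 x hx).2, neg_le_neg (hzmem.2.2 x hx).2⟩⟩
    -- Both solutions are constant iterations, so their fixed distance is at most a quantity tending
    -- to `0`.
    have hbound : ∀ n : ℕ, |z x - y x| ≤
        L ^ 2 / 4 * rate L a b c m N (fun x => -D L 2 α x) ^ n *
          supNorm L (fun x => D L 2 α x - D L 2 β x) := by
      intro n
      rw [mul_assoc]
      refine cz.abs_sub_le hL cy (fun t ht => ?_) x hx
      have := B.seq_contract (U := fun _ x => -D L 2 z x) (V := fun _ x => -D L 2 y x) hzm hym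
        (fun _ => isLinSol_of_isSolution hL hz) (fun _ => isLinSol_of_isSolution hL hy)
        (fun x hx => (hzm.abs_sub_le hym hx).trans (hS x hx)) n t ht
      rwa [neg_sub_neg, abs_sub_comm] at this
    have := ge_of_tendsto' lim1 hbound
    exact sub_eq_zero.1 (abs_nonpos_iff.1 this)
  · intro A Bs hA hBs
    obtain ⟨cA, sA⟩ := hA.isLinSol hL cα
    obtain ⟨cB, sB⟩ := hBs.isLinSol hL cβ
    have A0 : InOrder L (fun x => -D L 2 α x) (fun x => -D L 2 β x)
        (fun x => -D L 2 (A 0) x) := by rw [hA.1]; exact B.inOrder_lo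
    have B0 : InOrder L (fun x => -D L 2 α x) (fun x => -D L 2 β x)
        (fun x => -D L 2 (Bs 0) x) := by rw [hBs.1]; exact B.inOrder_hi
    have A1 := B.step_mem A0 (sA 0)
    have B1 := B.step_mem B0 (sB 0)
    have estA := hA.estimates B hρ1 hy hym cα B.inOrder_lo hS
    have estB := hBs.estimates B hρ1 hy hym cβ B.inOrder_hi hS
    have cont : ∀ {Y : ℕ → ℝ → ℝ}, (∀ n, IsC2Dirichlet L (Y n)) →
        ∀ n, ContinuousOn (fun x => Y n x - y x) (Icc 0 L) := fun hY n =>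
      (hY n).1.continuousOn.sub cy.1.continuousOn
    refine ⟨fun n => ⟨(cA n).below hL (cA (n + 1)) ?_, (cA n).below hL (cB n) ?_,
      (cB (n + 1)).below hL (cB n) ?_⟩, ?_, ?_, ?_, lim1, lim2⟩
    -- A sequence is compared with its shift; the initial inequality holds because the first step
    -- stays above `-α''` (for `Bs` below, under `-β''`).
    · refine B.seq_le (U := fun n x => -D L 2 (A n) x) (V := fun n x => -D L 2 (A (n + 1)) x)
        A0 A1 sA (fun n => sA (n + 1)) (fun x hx => ?_) n
      rw [hA.1]; exact (A1.2 x hx).1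
    · refine B.seq_le (U := fun n x => -D L 2 (A n) x) (V := fun n x => -D L 2 (Bs n) x)
        A0 B0 sA sB (fun x hx => ?_) n
      rw [hA.1]; exact (B0.2 x hx).1
    · refine B.seq_le (U := fun n x => -D L 2 (Bs (n + 1)) x) (V := fun n x => -D L 2 (Bs n) x)
        B1 B0 (fun n => sB (n + 1)) sB (fun x hx => ?_) n
      rw [hBs.1]; exact (B1.2 x hx).2
    · exact tendstoUniformlyOn_of_supNorm_le (cont cA)
        (fun n => (estA n).2.1.trans (estA n).2.2) lim2
    · exact tendstoUniformlyOn_of_supNorm_le (cont cB)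
        (fun n => (estB n).2.1.trans (estB n).2.2) lim2
    · rintro Y (rfl | rfl) n
      exacts [estA n, estB n]
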